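/- Let $n,q$ be nonnegative integers, let $a_p^j\in\mathbb R$ ($1\le p\le q$, $0\le j\le n$) and $\varepsilon_p\in\{1,-1\}$, and put, for $\eta\in\mathbb R^n$, $$\tilde g(\eta)=\sum_{p=1}^q\varepsilon_p\,\bigl|a_p^1\eta_1+\dots+a_p^n\eta_n+a_p^0\bigr|,\qquad g(\eta)=\sum_{p=1}^q\varepsilon_p\,\bigl|a_p^1\eta_1+\dots+a_p^n\eta_n\bigr|+\pi\sum_{k=1}^n(\eta_k-|\eta_k|).$$ The hyperplanes $a_p^1\eta_1+\dots+a_p^n\eta_n=0$ ($p=1,\dots,q$; forms that vanish identically are ignored) and $\eta_k=0$ ($k=1,\dots,n$) divide $\mathbb R^n$ into cones, which form a fan. Let $\mu_1,\dots,\mu_d$ be generators of the one-dimensional cones of this fan (one for each such cone), let $$P=\{\alpha\in\mathbb R^n:\ \langle\mu_\nu,\alpha\rangle\ge g(\mu_\nu),\ \nu=1,\dots,d\},$$ and let $P^\circ$ be the interior of $P$. Let $\operatorname{Arg}^{-1}(P^\circ)$ be the set of all $z\in(\mathbb C\setminus\{0\})^n$ for which there is $\alpha\in P^\circ$ with $z_j=|z_j|e^{i\alpha_j}$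 for $j=1,\dots,n$. **Theorem.** Let $f(z)=\sum_{k\in\mathbb Z_{\ge0}^n}f_kz^k$ be a power series in $n$ complex variables, and let $\varphi$ be a function that is holomorphic on (a neighbourhood of) $\mathbb R_{\ge0}^n+i\mathbb R^n$ and interpolates its coefficients, i.e. $\varphi(k)=f_k$ for all $k\in\mathbb Z_{\ge0}^n$. Assume that (with $\log 0=-\infty$) 1. $\log|\varphi(i\eta)|\le\tilde g(\eta)$ for all $\eta\in\mathbb R^n$; 2. there are real constants $b$, $C$ and $\delta>0$ with $$\log|\varphi(\xi+i\eta)|\le\sum_{j=1}^n\bigl((\pi-\delta)|\eta_j|+b\,\xi_j\bigr)+C\qquad\text{for all }\xi\in\mathbb R_{\ge0}^n,\ \eta\in\mathbb R^n.$$ Then the sum of the series extends analytically into $\operatorname{Arg}^{-1}(P^\circ)$: the domain of convergence $D$ of the series (the interior of the set of points of absolute convergence) contains $0$, and there is a holomorphic function on a neighbourhood of $D\cup\operatorname{Arg}^{-1}(P^\circ)$ which equals $f$ on $D$. -/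

import Mathlib

open Complex

namespace LeRoyLindelof

/-- `φ` is holomorphic on the (not necessarily open) set `S ⊆ ℂⁿ`: it is complex differentiable
on some open neighbourhood of `S`. -/
def HolomorphicOn {n : ℕ} (φ : (Fin n → ℂ) → ℂ) (S : Set (Fin n → ℂ)) : Prop :=
  ∃ U : Set (Fin n → ℂ), IsOpen U ∧ S ⊆ U ∧ DifferentiableOn ℂ φ U

/-- The closed domain `ℝ_{≥0}^n + iℝ^n`. -/
def closedRightDomain (n : ℕ) : Set (Fin n → ℂ) :=
  {ζ | ∀ j, 0 ≤ (ζ j).re}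

/-- The term `f_k z^k`, with `z^k = z_1^{k_1} ⋯ z_n^{k_n}`. -/
noncomputable def term {n : ℕ} (f : (Fin n → ℕ) → ℂ) (z : Fin n → ℂ) (k : Fin n → ℕ) : ℂ :=
  f k * ∏ j, z j ^ k j

/-- The domain of convergence of the multiple power series `∑ f_k z^k`: the interior of the set of
points where it converges absolutely. -/
def convergenceDomain {n : ℕ} (f : (Fin n → ℕ) → ℂ) : Set (Fin n → ℂ) :=
  interior {z | Summable fun k => ‖term f z k‖}

/-- `φ` interpolates the coefficients `f_k`. -/
def Interpolates {n : ℕ} (φ : (Fin n → ℂ) → ℂ) (f : (Fin n → ℕ) → ℂ) : Prop :=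
  ∀ k : Fin n → ℕ, φ (fun j => (k j : ℂ)) = f k

/-- The piecewise affine function
`g̃(η) = ∑_p ε_p |a_p^1 η_1 + ⋯ + a_p^n η_n + a_p^0|`. -/
def gTilde {n q : ℕ} (ε : Fin q → ℝ) (a : Fin q → Fin n → ℝ) (a₀ : Fin q → ℝ)
    (η : Fin n → ℝ) : ℝ :=
  ∑ p, ε p * |(∑ j, a p j * η j) + a₀ p|

/-- The associated piecewise linear function
`g(η) = ∑_p ε_p |a_p^1 η_1 + ⋯ + a_p^n η_n| + π ∑_k (η_k - |η_k|)`. -/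
noncomputable def gLin {n q : ℕ} (ε : Fin q → ℝ) (a : Fin q → Fin n → ℝ)
    (η : Fin n → ℝ) : ℝ :=
  ∑ p, ε p * |∑ j, a p j * η j| + Real.pi * ∑ k, (η k - |η k|)

/-- The linear forms whose zero sets are the hyperplanes `a_p^1 η_1 + ⋯ + a_p^n η_n = 0`
(`p = 1, …, q`) and `η_k = 0` (`k = 1, …, n`). -/
def form {n q : ℕ} (a : Fin q → Fin n → ℝ) : Fin q ⊕ Fin n → (Fin n → ℝ) → ℝ
  | Sum.inl p, η => ∑ j, a p j * η j
  | Sum.inr k, η => η k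

/-- The closed cone of the arrangement given by a choice of signs: the `i`-th form is
nonnegative, nonpositive or zero on it according to whether `s i` is `1`, `-1` or `0`. -/
def signCone {n q : ℕ} (a : Fin q → Fin n → ℝ) (s : Fin q ⊕ Fin n → SignType) :
    Set (Fin n → ℝ) :=
  {η | ∀ i, SignType.sign (form a i η) = 0 ∨ SignType.sign (form a i η) = s i}

/-- The fan into which the hyperplanes divide `ℝⁿ`, as the family of all its (closed) cones. -/
def fan {n q : ℕ} (a : Fin q → Fin n → ℝ) : Set (Set (Fin n → ℝ)) :=
  Set.range (signCone a)

/-- `μ` generates a one-dimensional cone of the fan. -/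
def IsRayGenerator {n q : ℕ} (a : Fin q → Fin n → ℝ) (μ : Fin n → ℝ) : Prop :=
  μ ≠ 0 ∧ {η : Fin n → ℝ | ∃ t : ℝ, 0 ≤ t ∧ η = t • μ} ∈ fan a

/-- The polytope `P = {α | (μ, α) ≥ g(μ) for the generators μ of the one-dimensional cones}`. As
`g` is positively homogeneous, it does not matter which generator of each ray is used. -/
def polytope {n q : ℕ} (ε : Fin q → ℝ) (a : Fin q → Fin n → ℝ) : Set (Fin n → ℝ) :=
  {α | ∀ μ, IsRayGenerator a μ → gLin ε a μ ≤ ∑ j, μ j * α j}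

/-- The sectorial domain `Arg⁻¹(A)`: the points of `(ℂ \ {0})ⁿ` which have a vector of arguments
in `A`. -/
def argPreimage {n : ℕ} (A : Set (Fin n → ℝ)) : Set (Fin n → ℂ) :=
  {z | ∃ α ∈ A, ∀ j, z j ≠ 0 ∧ z j = (‖z j‖ : ℂ) * exp ((α j : ℂ) * I)}

/-- The sum of the series `∑ f_k z^k` extends analytically into `S`: the series converges near the
origin, and there is a function which is holomorphic on `S` together with the domain of convergence
and which is the sum of the series on the domain of convergence. -/
def SumExtendsInto {n : ℕ} (f : (Fin n → ℕ) → ℂ) (S : Set (Fin n → ℂ)) : Prop :=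
  (0 : Fin n → ℂ) ∈ convergenceDomain f ∧
  ∃ F : (Fin n → ℂ) → ℂ, HolomorphicOn F (convergenceDomain f ∪ S) ∧
    ∀ z ∈ convergenceDomain f, HasSum (term f z) (F z)

end LeRoyLindelof

/-!
Write `z = e^w`, so that a sectorial domain becomes a tube `ℝⁿ + iA`. The continuation is given on
tubes by the Lindelöf integral `∫ φ(ζ) ∏ⱼ kernel(ζⱼ) e^{ζⱼ wⱼ}`, where every `ζⱼ` runs over a line
`Re ζⱼ = c` with small `c > 0` together with an atom at `0`; the atoms produce the terms whose index
has vanishing components, and the kernel `i / (1 - e^{2πiζ})` has its poles at the integers.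

*Convergence.* On the imaginary subspace `φ` is bounded by `e^{g̃}`, and the kernel contributes
`π ∑ (ηₖ - |ηₖ|)` to the exponent, so the integral should converge when `⟨η, α⟩ > g(η)` for all
`η ≠ 0`, where `α = Im w`. Since the lines lie at distance `c` from the imaginary axis, the bound has
to be carried inside: by the three lines theorem this costs only `O(c) |η|₁` in the exponent
(`exists_norm_le_near_imaginary`). Hence the integral is holomorphic over the vectors `α` that
satisfy the inequality with a margin `O(c)` (`differentiableAt_lindelofIntegral`), and as `c → 0`
these sets exhaust the interior of the polytope (`interior_polytope_subset`). There it matters that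
`g` and `|η|₁` are linear on the cones of the fan, so that the inequality with a margin passes from
the generators of the rays to all `η` (`slack_nonneg`).

*Value.* If `Re w` is very negative and `Im w` is close to `(π, …, π)`, the second growth condition
allows every line to be moved to the right across the poles, one variable at a time, and the
integral is the sum of the series (`lindelofIntegral_eq_tsum`). The set of admissible `α` is convex
and symmetric about `(π, …, π)`, so it contains this point whenever it is nonempty, and the identity
theorem gives equality wherever the series converges (`lindelofIntegral_eq_tsum_term`).

*Gluing.* Two choices of `c`, or two logarithms of the same `z`, give the same value: after a real
translation far to the left both integrals are the sum of the series at the same point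
(`tube_continuation_unique`). The integrals therefore descend to one function of `z`
(`sumExtendsInto_iUnion`).
-/

namespace LeRoyLindelof

open MeasureTheory Filter Topology

/-! ### Holomorphic functions of several variables -/

/-- Holomorphic dependence on a parameter. Only a bound for the integrand itself is required: the
bound for its derivative comes from the Cauchy estimate on smaller balls. -/
theorem differentiableAt_integral_of_dominated {X E : Type*} [MeasurableSpace X] {μ : Measure X}
    [NormedAddCommGroup E] [NormedSpace ℂ E] {F : E → X → ℂ} {w₀ : E} {r : ℝ} (hr : 0 < r)
    {bound : X → ℝ} (hbound : Integrable bound μ)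
    (hmeas : ∀ w ∈ Metric.ball w₀ r, AEStronglyMeasurable (F w) μ)
    (hmeas' : AEStronglyMeasurable (fun x => fderiv ℂ (fun w => F w x) w₀) μ)
    (hdiff : ∀ᵐ x ∂μ, ∀ w ∈ Metric.ball w₀ r, DifferentiableAt ℂ (fun w => F w x) w)
    (hle : ∀ᵐ x ∂μ, ∀ w ∈ Metric.ball w₀ r, ‖F w x‖ ≤ bound x) :
    DifferentiableAt ℂ (fun w => ∫ x, F w x ∂μ) w₀ := by
  have hsub : ∀ w ∈ Metric.ball w₀ (r / 2), Metric.ball w (r / 2) ⊆ Metric.ball w₀ r := by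
    intro w hw
    refine Metric.ball_subset_ball' ?_
    rw [Metric.mem_ball] at hw
    linarith
  have h := hasFDerivAt_integral_of_dominated_of_fderiv_le (μ := μ) (𝕜 := ℂ) (F := F) (x₀ := w₀)
    (s := Metric.ball w₀ (r / 2)) (F' := fun w x => fderiv ℂ (fun w => F w x) w)
    (bound := fun x => 2 * bound x / (r / 2)) (Metric.ball_mem_nhds _ (by positivity))
    (by filter_upwards [Metric.ball_mem_nhds w₀ hr] with w hw using hmeas w hw)
    (hbound.mono' (hmeas w₀ (Metric.mem_ball_self hr))
      (by filter_upwards [hle] with x hx using hx w₀ (Metric.mem_ball_self hr)))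
    hmeas' ?_ ((hbound.const_mul 2).div_const _) ?_
  · exact h.differentiableAt
  · filter_upwards [hle, hdiff] with x hx hd w hw
    refine Complex.norm_fderiv_le_div_of_mapsTo_ball
      (fun v hv => (hd v (hsub w hw hv)).differentiableWithinAt) ?_ (by positivity)
    intro v hv
    rw [mem_closedBall_iff_norm]
    have h1 := hx v (hsub w hw hv)
    have h2 := hx w (hsub w hw (Metric.mem_ball_self (by positivity)))
    linarith [norm_sub_le (F v x) (F w x)]
  · filter_upwards [hdiff] with x hd w hw
    exact (hd w (Metric.ball_subset_ball (by linarith) hw)).hasFDerivAt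

/-- The identity theorem on a convex open set, by restriction to the complex line through a point
and the base point. -/
theorem eqOn_of_convex_of_eventuallyEq {E : Type*} [NormedAddCommGroup E] [NormedSpace ℂ E]
    {T : Set E} (hTo : IsOpen T) (hTc : Convex ℝ T) {F G : E → ℂ}
    (hF : ∀ w ∈ T, DifferentiableAt ℂ F w) (hG : ∀ w ∈ T, DifferentiableAt ℂ G w)
    {w₀ : E} (hw₀ : w₀ ∈ T) (h : F =ᶠ[𝓝 w₀] G) {w : E} (hw : w ∈ T) : F w = G w := by
  set p : ℂ → E := fun t => w₀ + t • (w - w₀) with hp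
  have hpd : Differentiable ℂ p := by fun_prop
  have hpc : Continuous p := hpd.continuous
  have hS : IsOpen (p ⁻¹' T) := hTo.preimage hpc
  have hSc : Convex ℝ (p ⁻¹' T) := by
    intro s hs t ht α β hα hβ hαβ
    have := hTc hs ht hα hβ hαβ
    have e : p (α • s + β • t) = α • p s + β • p t := by
      simp only [hp, smul_add, add_smul, smul_assoc]
      rw [show α • w₀ + α • s • (w - w₀) + (β • w₀ + β • t • (w - w₀))
        = (α + β) • w₀ + (α • s • (w - w₀) + β • t • (w - w₀)) by rw [add_smul]; abel, hαβ, one_smul]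
    rw [Set.mem_preimage, e]
    exact this
  have key : Set.EqOn (F ∘ p) (G ∘ p) (p ⁻¹' T) := by
    refine AnalyticOnNhd.eqOn_of_preconnected_of_eventuallyEq (z₀ := 0)
      (DifferentiableOn.analyticOnNhd (fun t ht => ?_) hS)
      (DifferentiableOn.analyticOnNhd (fun t ht => ?_) hS) hSc.isPreconnected ?_ ?_
    · exact ((hF _ ht).comp t hpd.differentiableAt).differentiableWithinAt
    · exact ((hG _ ht).comp t hpd.differentiableAt).differentiableWithinAt
    · simpa [hp] using hw₀
    · have : Tendsto p (𝓝 0) (𝓝 w₀) := by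
        have := hpc.tendsto 0
        simpa [hp] using this
      exact this.eventually h
  have := key (x := 1) (by simpa [hp] using hw)
  simpa [hp] using this

theorem integrable_exp_neg_mul_abs {s : ℝ} (hs : 0 < s) :
    Integrable fun t : ℝ => Real.exp (-(s * |t|)) := by
  rw [← integrableOn_univ, ← Set.Iic_union_Ioi (a := (0 : ℝ)), integrableOn_union]
  constructor
  · refine (integrableOn_exp_mul_Iic hs 0).congr_fun (fun t ht => ?_) measurableSet_Iic
    simp only [abs_of_nonpos (Set.mem_Iic.1 ht)]; ring_nf
  · refine (integrableOn_exp_mul_Ioi (a := -s) (by linarith) 0).congr_fun (fun t ht => ?_)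
      measurableSet_Ioi
    simp only [abs_of_pos (Set.mem_Ioi.1 ht)]; ring_nf

/-! ### Shifting vertical lines of integration -/

theorem integrable_of_continuous_of_norm_le {g : ℝ → ℂ} (hg : Continuous g) {K : ℝ}
    (hK : ∀ t, 1 ≤ |t| → ‖g t‖ ≤ K * (1 + t ^ 2)⁻¹) : Integrable g := by
  obtain ⟨B, hB⟩ := (isCompact_Icc (a := (-1 : ℝ)) (b := 1)).exists_bound_of_continuousOn
    hg.continuousOn
  refine (integrable_inv_one_add_sq.const_mul (max K (2 * B))).mono' hg.aestronglyMeasurable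
    (Eventually.of_forall fun t => ?_)
  have hp : 0 < (1 + t ^ 2)⁻¹ := by positivity
  rcases le_or_gt 1 |t| with ht | ht
  · exact (hK t ht).trans (mul_le_mul_of_nonneg_right (le_max_left _ _) hp.le)
  · have h1 := hB t ⟨(abs_lt.1 ht).1.le, (abs_lt.1 ht).2.le⟩
    have h2 : (1 : ℝ) / 2 ≤ (1 + t ^ 2)⁻¹ := by
      rw [one_div]
      have := (sq_lt_one_iff_abs_lt_one t).2 ht
      exact inv_anti₀ (by positivity) (by linarith)
    have hB0 : 0 ≤ B := (norm_nonneg _).trans h1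
    calc ‖g t‖ ≤ 2 * B * (1 / 2) := by linarith
      _ ≤ 2 * B * (1 + t ^ 2)⁻¹ := by gcongr
      _ ≤ _ := mul_le_mul_of_nonneg_right (le_max_right _ _) hp.le

/-- Cauchy's theorem for an infinite vertical strip. -/
theorem integral_vertical_eq_of_differentiableOn {Q : ℂ → ℂ} {a b K : ℝ} (hab : a ≤ b)
    (hQ : DifferentiableOn ℂ Q (re ⁻¹' Set.Icc a b))
    (hK : ∀ ζ : ℂ, ζ.re ∈ Set.Icc a b → 1 ≤ |ζ.im| → ‖Q ζ‖ ≤ K * (1 + ζ.im ^ 2)⁻¹) :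
    ∫ t : ℝ, Q (b + t * I) = ∫ t : ℝ, Q (a + t * I) := by
  have hcont : ∀ c ∈ Set.Icc a b, Continuous fun t : ℝ => Q (c + t * I) := by
    intro c hc
    rw [← continuousOn_univ]
    exact hQ.continuousOn.comp (by fun_prop) (fun t _ => by simpa using hc)
  have hint : ∀ c ∈ Set.Icc a b, Integrable fun t : ℝ => Q (c + t * I) := fun c hc =>
    integrable_of_continuous_of_norm_le (hcont c hc) (K := K)
      (fun t ht => by simpa using hK (c + t * I) (by simpa using hc) (by simpa using ht))
  have hv : ∀ c ∈ Set.Icc a b, Tendsto (fun T : ℝ => ∫ y in (-T)..T, Q (c + y * I)) atTop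
      (𝓝 (∫ t : ℝ, Q (c + t * I))) := fun c hc =>
    intervalIntegral_tendsto_integral (hint c hc) tendsto_neg_atTop_atBot tendsto_id
  have hdecay : Tendsto (fun T : ℝ => K * (1 + T ^ 2)⁻¹ * |b - a|) atTop (𝓝 0) := by
    have : Tendsto (fun T : ℝ => (1 + T ^ 2)) atTop atTop :=
      tendsto_atTop_add_const_left _ _ (tendsto_pow_atTop two_ne_zero)
    simpa using (this.inv_tendsto_atTop.const_mul K).mul_const |b - a|
  have hh : ∀ σ : ℝ, |σ| = 1 →
      Tendsto (fun T : ℝ => ∫ x in a..b, Q (x + ((σ * T : ℝ) : ℂ) * I)) atTop (𝓝 0) := by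
    intro σ hσ
    refine squeeze_zero_norm' ?_ hdecay
    filter_upwards [eventually_ge_atTop 1] with T hT
    refine intervalIntegral.norm_integral_le_of_norm_le_const fun x hx => ?_
    have hx' : x ∈ Set.Icc a b := by
      rw [Set.uIoc_of_le hab] at hx
      exact Set.Ioc_subset_Icc_self hx
    have hσ2 : σ ^ 2 = 1 := by rw [← sq_abs, hσ, one_pow]
    have h := hK (x + ((σ * T : ℝ) : ℂ) * I) (by simpa using hx')
      (by
        have : ((x : ℂ) + ((σ * T : ℝ) : ℂ) * I).im = σ * T := by simp
        rw [this, abs_mul, hσ, one_mul]; exact hT.trans (le_abs_self T))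
    have him : ((x : ℂ) + ((σ * T : ℝ) : ℂ) * I).im ^ 2 = T ^ 2 := by
      have : ((x : ℂ) + ((σ * T : ℝ) : ℂ) * I).im = σ * T := by simp
      rw [this, mul_pow, hσ2, one_mul]
    rwa [him] at h
  have hrect : ∀ T : ℝ, ((∫ x in a..b, Q (x + ((-1 * T : ℝ) : ℂ) * I)) -
      ∫ x in a..b, Q (x + ((1 * T : ℝ) : ℂ) * I)) + I * (∫ y in (-T)..T, Q (b + y * I)) -
        I * ∫ y in (-T)..T, Q (a + y * I) = 0 := by
    intro T
    have := Complex.integral_boundary_rect_eq_zero_of_differentiableOn Q (a + ((-T : ℝ) : ℂ) * I)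
      (b + ((T : ℝ) : ℂ) * I) (hQ.mono fun z hz => by
        have := hz.1
        simpa [Set.uIcc_of_le hab] using this)
    simpa using this
  have hlim := ((hh (-1) (by simp)).sub (hh 1 (by simp))).add
    ((hv b ⟨hab, le_rfl⟩).const_mul I) |>.sub ((hv a ⟨le_rfl, hab⟩).const_mul I)
  simp only [hrect] at hlim
  have h0 := tendsto_nhds_unique hlim tendsto_const_nhds
  have : I * ((∫ t : ℝ, Q (b + t * I)) - ∫ t : ℝ, Q (a + t * I)) = 0 := by
    rw [← h0]; ring
  exact sub_eq_zero.1 ((mul_eq_zero.1 this).resolve_left I_ne_zero)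

theorem norm_inv_mul_one_sub_le {u : ℂ} (hu : 1 ≤ |u.im|) :
    ‖(u * (1 - u))⁻¹‖ ≤ 2 * (1 + u.im ^ 2)⁻¹ := by
  have h1 := abs_im_le_norm u
  have h2 : |u.im| ≤ ‖1 - u‖ := by simpa using abs_im_le_norm (1 - u)
  have h3 : u.im ^ 2 ≤ ‖u * (1 - u)‖ := by
    rw [norm_mul, ← sq_abs, sq]
    gcongr
  have h4 : 1 ≤ u.im ^ 2 := by rw [← sq_abs]; exact one_le_pow₀ hu
  rw [norm_inv, ← div_eq_mul_inv, inv_le_comm₀ (by linarith) (by positivity), inv_div]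
  linarith

/-- With the next lemma this gives the contribution of the model pole `1 / (u (1 - u))` at the
origin, which decays fast enough to be integrated over vertical lines. -/
theorem integral_inv_mul_one_sub_of_neg {c : ℝ} (hc : c < 0) :
    ∫ t : ℝ, (((c : ℂ) + t * I) * (1 - (c + t * I)))⁻¹ = 0 := by
  have hne : ∀ t : ℝ, (c : ℂ) + t * I ≠ 0 := fun t h => by
    have := congrArg re h; simp at this; linarith
  have hne1 : ∀ t : ℝ, (c : ℂ) + t * I - 1 ≠ 0 := fun t h => by
    have := congrArg re h; simp at this; linarith
  have hne1' : ∀ t : ℝ, 1 - ((c : ℂ) + t * I) ≠ 0 := fun t h => hne1 t (by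
    rw [← neg_sub, h, neg_zero])
  have hcont : Continuous fun t : ℝ => (((c : ℂ) + t * I) * (1 - (c + t * I)))⁻¹ :=
    Continuous.inv₀ (by fun_prop) fun t => mul_ne_zero (hne t) (hne1' t)
  have hint : Integrable fun t : ℝ => (((c : ℂ) + t * I) * (1 - (c + t * I)))⁻¹ :=
    integrable_of_continuous_of_norm_le hcont (K := 2) fun t ht => by
      simpa using norm_inv_mul_one_sub_le (u := c + t * I) (by simpa using ht)
  -- the primitive `-i log (1 + 1 / (u - 1))` tends to zero at both ends of the line
  have hslit : ∀ t : ℝ, 1 + ((c : ℂ) + t * I - 1)⁻¹ ∈ slitPlane := by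
    intro t
    left
    have : 0 < normSq ((c : ℂ) + t * I - 1) := normSq_pos.2 (hne1 t)
    rw [add_re, inv_re, one_re]
    have h2 : normSq ((c : ℂ) + t * I - 1) = (c - 1) ^ 2 + t ^ 2 := by
      rw [normSq_apply]; simp; ring
    have h3 : ((c : ℂ) + t * I - 1).re = c - 1 := by simp
    rw [h3, ← neg_lt_iff_pos_add', neg_lt_iff_pos_add, h2]
    rw [h2] at this
    rw [div_add_one this.ne']
    apply div_pos _ this
    nlinarith [sq_nonneg t]
  have hderiv : ∀ t : ℝ, HasDerivAt (fun t : ℝ => -I * log (1 + ((c : ℂ) + t * I - 1)⁻¹))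
      ((((c : ℂ) + t * I) * (1 - (c + t * I)))⁻¹) t := by
    intro t
    have h1 : HasDerivAt (fun t : ℝ => (c : ℂ) + t * I - 1) I t := by
      simpa using ((((hasDerivAt_id (t : ℂ)).comp_ofReal).mul_const I).const_add (c : ℂ)).sub_const 1
    have h2 := (((h1.inv (hne1 t)).const_add 1).clog_real (hslit t)).const_mul (-I)
    refine h2.congr_deriv ?_
    have e : 1 + ((c : ℂ) + t * I - 1)⁻¹ = (c + t * I) / (c + t * I - 1) := by
      field_simp [hne1 t]; ring
    simp only [Pi.inv_apply]
    rw [e]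
    have h3 := hne t
    have h4 := hne1 t
    generalize (c : ℂ) + t * I = u at h3 h4 ⊢
    rw [show 1 - u = -(u - 1) by ring]
    field_simp
    simp
  have htend : ∀ l : Filter ℝ, Tendsto (fun t : ℝ => |t|) l atTop →
      Tendsto (fun t : ℝ => -I * log (1 + ((c : ℂ) + t * I - 1)⁻¹)) l (𝓝 0) := by
    intro l hl
    have h1 : Tendsto (fun t : ℝ => ‖(c : ℂ) + t * I - 1‖) l atTop :=
      tendsto_atTop_mono (fun t => by simpa using abs_im_le_norm ((c : ℂ) + t * I - 1)) hl
    have h2 : Tendsto (fun t : ℝ => ((c : ℂ) + t * I - 1)⁻¹) l (𝓝 0) :=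
      tendsto_zero_iff_norm_tendsto_zero.2 (by
      simp only [norm_inv]; exact h1.inv_tendsto_atTop)
    have h3 := (h2.const_add 1).clog (by simp)
    simpa using h3.const_mul (-I)
  have := integral_of_hasDerivAt_of_tendsto hderiv hint (htend _ tendsto_abs_atBot_atTop)
    (htend _ tendsto_abs_atTop_atTop)
  simpa using this

theorem integral_inv_mul_one_sub_of_mem_Ioo {c : ℝ} (hc : c ∈ Set.Ioo (0 : ℝ) 1) :
    ∫ t : ℝ, (((c : ℂ) + t * I) * (1 - (c + t * I)))⁻¹ = 2 * Real.pi := by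
  have hshift : ∀ a b : ℝ, a ∈ Set.Ioo (0 : ℝ) 1 → b ∈ Set.Ioo (0 : ℝ) 1 → a ≤ b →
      ∫ t : ℝ, (((b : ℂ) + t * I) * (1 - (b + t * I)))⁻¹ =
        ∫ t : ℝ, (((a : ℂ) + t * I) * (1 - (a + t * I)))⁻¹ := by
    intro a b ha hb hab
    refine integral_vertical_eq_of_differentiableOn (Q := fun u => (u * (1 - u))⁻¹) hab ?_
      (K := 2) fun u _ hu => norm_inv_mul_one_sub_le hu
    intro u hu
    have h1 : u ≠ 0 := fun h => by
      have := hu.1; rw [h] at this; simp at this; linarith [ha.1]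
    have h2 : 1 - u ≠ 0 := fun h => by
      have h' : u = 1 := (sub_eq_zero.1 h).symm
      have := hu.2; rw [h'] at this; simp at this; linarith [hb.2]
    have h3 : u * (1 - u) ≠ 0 := mul_ne_zero h1 h2
    have h4 : DifferentiableAt ℂ (fun u : ℂ => u * (1 - u)) u := by fun_prop
    exact (h4.inv h3).differentiableWithinAt
  have hhalf : (1 / 2 : ℝ) ∈ Set.Ioo (0 : ℝ) 1 := by norm_num
  have h1 : ∫ t : ℝ, (((c : ℂ) + t * I) * (1 - (c + t * I)))⁻¹ =
      ∫ t : ℝ, ((((1 / 2 : ℝ) : ℂ) + t * I) * (1 - (((1 / 2 : ℝ) : ℂ) + t * I)))⁻¹ := by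
    rcases le_total c (1 / 2) with h | h
    · exact (hshift _ _ hc hhalf h).symm
    · exact hshift _ _ hhalf hc h
  rw [h1]
  have h2 : ∀ t : ℝ, ((((1 / 2 : ℝ) : ℂ) + t * I) * (1 - (((1 / 2 : ℝ) : ℂ) + t * I)))⁻¹ =
      ((4 * (1 + (2 * t) ^ 2)⁻¹ : ℝ) : ℂ) := by
    intro t
    have : ((((1 / 2 : ℝ) : ℂ) + t * I) * (1 - (((1 / 2 : ℝ) : ℂ) + t * I))) =
        (((1 + (2 * t) ^ 2) / 4 : ℝ) : ℂ) := by
      push_cast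
      linear_combination (-(t : ℂ) ^ 2) * I_sq
    rw [this, ← ofReal_inv, inv_div, div_eq_mul_inv]
  simp_rw [h2]
  rw [integral_complex_ofReal, integral_const_mul,
    Measure.integral_comp_mul_left (fun t => (1 + t ^ 2)⁻¹) 2, integral_univ_inv_one_add_sq,
    abs_of_pos (by norm_num)]
  simp only [smul_eq_mul]
  push_cast
  ring

/-- The residue theorem for a simple pole at the origin, on the strip between the lines
`Re u = c - 1` and `Re u = c`. -/
theorem integral_vertical_sub_of_simple_pole {N : ℂ → ℂ} {c K : ℝ} (hc : c ∈ Set.Ioo (0 : ℝ) 1)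
    (hN : DifferentiableOn ℂ N (re ⁻¹' Set.Ioo (-1) 1))
    (hK : ∀ u : ℂ, u.re ∈ Set.Icc (c - 1) c → 1 ≤ |u.im| → ‖N u / u‖ ≤ K * (1 + u.im ^ 2)⁻¹) :
    (∫ t : ℝ, N (c + t * I) / (c + t * I)) -
      ∫ t : ℝ, N ((c - 1 : ℝ) + t * I) / ((c - 1 : ℝ) + t * I) = 2 * Real.pi * N 0 := by
  -- subtract `N 0 / (u (1 - u))`, which has the same residue at the origin
  set R : ℂ → ℂ := fun u => N u - N 0 * (1 - u)⁻¹ with hR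
  have hS : IsOpen (re ⁻¹' Set.Ioo (-1) 1 : Set ℂ) := isOpen_Ioo.preimage continuous_re
  have hRd : DifferentiableOn ℂ R (re ⁻¹' Set.Ioo (-1) 1) := by
    refine hN.sub fun u hu => ?_
    have h2 : 1 - u ≠ 0 := fun h => by
      have h' : u = 1 := (sub_eq_zero.1 h).symm
      have := hu.2; rw [h'] at this; simp at this
    exact ((DifferentiableAt.inv (by fun_prop) h2).const_mul _).differentiableWithinAt
  have hD : DifferentiableOn ℂ (dslope R 0) (re ⁻¹' Set.Ioo (-1) 1) :=
    (Complex.differentiableOn_dslope (hS.mem_nhds (by simp))).2 hRd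
  have heq : ∀ u : ℂ, u ≠ 0 → dslope R 0 u = N u / u - N 0 * (u * (1 - u))⁻¹ := by
    intro u hu
    rw [dslope_of_ne _ hu, slope_def_field]
    simp only [hR, sub_zero, inv_one, mul_one, sub_self, mul_inv]
    field_simp
  have hne : ∀ a : ℝ, a ≠ 0 → ∀ t : ℝ, (a : ℂ) + t * I ≠ 0 := fun a ha t h => ha (by
    have := congrArg re h; simpa using this)
  have hsub : (re ⁻¹' Set.Icc (c - 1) c : Set ℂ) ⊆ re ⁻¹' Set.Ioo (-1) 1 := fun u hu =>
    ⟨by linarith [hu.1, hc.1], lt_of_le_of_lt hu.2 hc.2⟩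
  have hshift := integral_vertical_eq_of_differentiableOn (Q := dslope R 0) (a := c - 1) (b := c)
    (K := K + ‖N 0‖ * 2) (by linarith) (hD.mono hsub) (by
      intro u hu hu1
      have hu0 : u ≠ 0 := by rintro rfl; simp at hu1; linarith
      rw [heq u hu0, add_mul, mul_assoc]
      refine (norm_sub_le _ _).trans (add_le_add (hK u hu hu1) ?_)
      rw [norm_mul]
      gcongr
      exact norm_inv_mul_one_sub_le hu1)
  have hNint : ∀ a : ℝ, a ∈ Set.Icc (c - 1) c → a ≠ 0 →
      Integrable fun t : ℝ => N (a + t * I) / (a + t * I) := by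
    intro a ha ha0
    refine integrable_of_continuous_of_norm_le (K := K) ?_ fun t ht => by
      simpa using hK (a + t * I) (by simpa using ha) (by simpa using ht)
    refine Continuous.div ?_ (by fun_prop) (hne a ha0)
    rw [← continuousOn_univ]
    exact hN.continuousOn.comp (by fun_prop) fun t _ => hsub (by simpa using ha)
  have hpint : ∀ a : ℝ, a ≠ 0 → a ≠ 1 →
      Integrable fun t : ℝ => N 0 * (((a : ℂ) + t * I) * (1 - (a + t * I)))⁻¹ := by
    intro a ha0 ha1
    refine Integrable.const_mul (integrable_of_continuous_of_norm_le (K := 2) ?_ fun t ht => by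
      simpa using norm_inv_mul_one_sub_le (u := a + t * I) (by simpa using ht)) _
    refine Continuous.inv₀ (by fun_prop) fun t => mul_ne_zero (hne a ha0 t) fun h => ha1 ?_
    have := congrArg re h
    simp at this
    linarith
  have hc0 : c ≠ 0 := hc.1.ne'
  have hc1 : c - 1 ≠ 0 := (by linarith [hc.2] : c - 1 < 0).ne
  have e1 : ∫ t : ℝ, dslope R 0 (c + t * I) =
      (∫ t : ℝ, N (c + t * I) / (c + t * I)) - N 0 * (2 * Real.pi) := by
    rw [← integral_inv_mul_one_sub_of_mem_Ioo hc, ← integral_const_mul,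
      ← integral_sub (hNint c ⟨by linarith, le_rfl⟩ hc0) (hpint c hc0 hc.2.ne)]
    exact integral_congr_ae (Eventually.of_forall fun t => heq _ (hne c hc0 t))
  have e2 : ∫ t : ℝ, dslope R 0 ((c - 1 : ℝ) + t * I) =
      (∫ t : ℝ, N ((c - 1 : ℝ) + t * I) / ((c - 1 : ℝ) + t * I)) - N 0 * 0 := by
    have h0 := integral_inv_mul_one_sub_of_neg (show c - 1 < 0 by linarith [hc.2])
    rw [show N 0 * 0 = N 0 * ∫ t : ℝ, (((c - 1 : ℝ) + t * I) *
        (1 - ((c - 1 : ℝ) + t * I)))⁻¹ by rw [h0], ← integral_const_mul,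
      ← integral_sub (hNint (c - 1) ⟨le_rfl, by linarith⟩ hc1)
        (hpint (c - 1) hc1 (by linarith [hc.2]))]
    exact integral_congr_ae (Eventually.of_forall fun t => heq _ (hne (c - 1) hc1 t))
  rw [e1, e2] at hshift
  linear_combination hshift

/-! ### The one-variable Lindelöf representation -/

/-- The factor `i / (1 - e^{2πiζ})`, which has simple poles at the integers. At the origin, where the
contour of integration carries an atom, the value is set to `1`. -/
noncomputable def kernel (ζ : ℂ) : ℂ :=
  if ζ = 0 then 1 else I / (1 - exp (2 * Real.pi * I * ζ))

/-- Integration over the line `Re ζ = c` together with evaluation at the origin. The atom accounts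
for the terms of the power series of index zero, so that the line can stay to the right of the
imaginary axis. -/
noncomputable def contourMeasure (c : ℝ) : Measure ℂ :=
  Measure.dirac 0 + (volume : Measure ℝ).map fun t : ℝ => (c : ℂ) + t * I

theorem measurable_line (c : ℝ) : Measurable fun t : ℝ => (c : ℂ) + t * I := by fun_prop

theorem measurableEmbedding_line (c : ℝ) : MeasurableEmbedding fun t : ℝ => (c : ℂ) + t * I := by
  exact Continuous.measurableEmbedding (by fun_prop) (fun s t h => by simpa using congrArg im h)

instance (c : ℝ) : SigmaFinite (contourMeasure c) := by
  unfold contourMeasure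
  have := (measurableEmbedding_line c).sigmaFinite_map (μ := volume)
  infer_instance

theorem measurable_kernel : Measurable kernel := by
  unfold kernel
  exact Measurable.ite (measurableSet_singleton 0) measurable_const (by fun_prop)

theorem ae_contourMeasure (c : ℝ) : ∀ᵐ ζ ∂contourMeasure c, ζ = 0 ∨ ζ.re = c := by
  unfold contourMeasure
  rw [ae_add_measure_iff]
  have hm : MeasurableSet {ζ : ℂ | ζ = 0 ∨ ζ.re = c} :=
    (measurableSet_singleton 0).union (measurable_re (measurableSet_singleton c))
  refine ⟨?_, ?_⟩
  · rw [ae_dirac_iff hm]; exact Or.inl rfl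
  · rw [ae_map_iff (measurable_line c).aemeasurable hm]
    exact Eventually.of_forall fun t => Or.inr (by simp)

theorem integrable_contourMeasure_iff {c : ℝ} {g : ℂ → ℂ} :
    Integrable g (contourMeasure c) ↔ Integrable fun t : ℝ => g (c + t * I) := by
  unfold contourMeasure
  rw [integrable_add_measure, (measurableEmbedding_line c).integrable_map_iff]
  exact and_iff_right (integrable_dirac (by simp))

theorem integral_contourMeasure {c : ℝ} {g : ℂ → ℂ} (hg : Integrable g (contourMeasure c)) :
    ∫ ζ, g ζ ∂contourMeasure c = g 0 + ∫ t : ℝ, g (c + t * I) := by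
  have h := hg
  unfold contourMeasure at h ⊢
  rw [integrable_add_measure] at h
  rw [integral_add_measure h.1 h.2, integral_dirac, (measurableEmbedding_line c).integral_map]

theorem integrable_exp_neg_mul_abs_im (c : ℝ) {s : ℝ} (hs : 0 < s) :
    Integrable (fun ζ : ℂ => Real.exp (-(s * |ζ.im|))) (contourMeasure c) := by
  unfold contourMeasure
  rw [integrable_add_measure, (measurableEmbedding_line c).integrable_map_iff]
  refine ⟨integrable_dirac (by simp), ?_⟩
  simpa [Function.comp_def] using integrable_exp_neg_mul_abs hs

theorem norm_exp_two_pi_mul (ζ : ℂ) :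
    ‖exp (2 * Real.pi * I * ζ)‖ = Real.exp (-(2 * Real.pi * ζ.im)) := by
  rw [norm_exp]; simp

/-- Away from its poles the kernel is at most a constant times `exp (π (Im ζ - |Im ζ|))`. This is the
bound at distance at least one from the real axis. -/
theorem norm_kernel_le_of_one_le {ζ : ℂ} (h : 1 ≤ |ζ.im|) :
    ‖I / (1 - exp (2 * Real.pi * I * ζ))‖ ≤ 2 * Real.exp (Real.pi * (ζ.im - |ζ.im|)) := by
  have hn := norm_exp_two_pi_mul ζ
  have hpi := Real.pi_gt_three
  have h2 : 2 ≤ Real.exp (2 * Real.pi) := by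
    have := Real.add_one_le_exp (2 * Real.pi); linarith
  set e := exp (2 * Real.pi * I * ζ) with he
  rw [norm_div, norm_I]
  rcases le_abs.1 h with h1 | h1
  · rw [abs_of_nonneg (by linarith), sub_self, mul_zero, Real.exp_zero]
    have h3 : ‖e‖ ≤ 1 / 2 := by
      rw [hn, Real.exp_neg, ← one_div]
      refine one_div_le_one_div_of_le two_pos (h2.trans (Real.exp_le_exp.2 ?_))
      nlinarith
    have h4 : 1 - ‖e‖ ≤ ‖1 - e‖ := by simpa using norm_sub_norm_le 1 e
    rw [div_le_iff₀ (by linarith)]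
    linarith
  · rw [abs_of_nonpos (by linarith)]
    have h3 : 2 ≤ ‖e‖ := by
      rw [hn]
      refine h2.trans (Real.exp_le_exp.2 ?_)
      nlinarith
    have h4 : ‖e‖ - 1 ≤ ‖1 - e‖ := by
      rw [norm_sub_rev]; simpa using norm_sub_norm_le e 1
    have h5 : Real.exp (Real.pi * (ζ.im - -ζ.im)) = ‖e‖⁻¹ := by
      rw [hn, ← Real.exp_neg]; ring_nf
    rw [h5, ← div_eq_mul_inv, div_le_div_iff₀ (by linarith) (by linarith)]
    linarith

/-- The same bound on the lines `Re ζ = m + c`. The modulus of `1 - e^{2πiζ}` is bounded below by its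
imaginary part, and also by `|e^{2πiζ}|` times the imaginary part of `e^{-2πiζ}`. -/
theorem norm_kernel_le_of_re_eq {ζ : ℂ} {c : ℝ} (hc : c ∈ Set.Ioo (0 : ℝ) (1 / 4)) {m : ℕ}
    (h : ζ.re = m + c) :
    ‖I / (1 - exp (2 * Real.pi * I * ζ))‖ ≤
      (Real.sin (2 * Real.pi * c))⁻¹ * Real.exp (Real.pi * (ζ.im - |ζ.im|)) := by
  have hn := norm_exp_two_pi_mul ζ
  have hpi := Real.pi_pos
  have hs : 0 < Real.sin (2 * Real.pi * c) := by
    apply Real.sin_pos_of_pos_of_lt_pi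
    · have := hc.1; positivity
    · nlinarith [hc.2]
  have him : (exp (2 * Real.pi * I * ζ)).im =
      Real.exp (-(2 * Real.pi * ζ.im)) * Real.sin (2 * Real.pi * c) := by
    rw [exp_im]
    have h1 : (2 * Real.pi * I * ζ).re = -(2 * Real.pi * ζ.im) := by simp
    have h2 : (2 * Real.pi * I * ζ).im = 2 * Real.pi * c + m * (2 * Real.pi) := by
      simp [h]; ring
    rw [h1, h2, Real.sin_add_nat_mul_two_pi]
  have him' : (exp (-(2 * Real.pi * I * ζ))).im =
      -(Real.exp (2 * Real.pi * ζ.im) * Real.sin (2 * Real.pi * c)) := by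
    rw [exp_im]
    have h1 : (-(2 * Real.pi * I * ζ)).re = 2 * Real.pi * ζ.im := by simp
    have h2 : (-(2 * Real.pi * I * ζ)).im = -(2 * Real.pi * c + m * (2 * Real.pi)) := by
      simp [h]; ring
    rw [h1, h2, Real.sin_neg, Real.sin_add_nat_mul_two_pi]; ring
  have hl1 : Real.exp (-(2 * Real.pi * ζ.im)) * Real.sin (2 * Real.pi * c) ≤
      ‖1 - exp (2 * Real.pi * I * ζ)‖ := by
    have := abs_im_le_norm (1 - exp (2 * Real.pi * I * ζ))
    rw [sub_im, one_im, him, zero_sub, abs_neg, abs_of_pos (by positivity)] at this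
    exact this
  have hl2 : Real.sin (2 * Real.pi * c) ≤ ‖1 - exp (2 * Real.pi * I * ζ)‖ := by
    have e : 1 - exp (2 * Real.pi * I * ζ) =
        exp (2 * Real.pi * I * ζ) * (exp (-(2 * Real.pi * I * ζ)) - 1) := by
      rw [mul_sub, ← exp_add]; simp
    have := abs_im_le_norm (exp (-(2 * Real.pi * I * ζ)) - 1)
    rw [sub_im, one_im, him', sub_zero, abs_neg, abs_of_pos (by positivity)] at this
    rw [e, norm_mul, hn]
    calc Real.sin (2 * Real.pi * c) = Real.exp (-(2 * Real.pi * ζ.im)) *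
          (Real.exp (2 * Real.pi * ζ.im) * Real.sin (2 * Real.pi * c)) := by
          rw [← mul_assoc, ← Real.exp_add]; simp
      _ ≤ _ := by gcongr
  rw [norm_div, norm_I, one_div, ← inv_inv (Real.exp _), ← mul_inv, ← Real.exp_neg]
  refine inv_anti₀ (by positivity) ?_
  rcases le_total 0 ζ.im with h1 | h1
  · rw [abs_of_nonneg h1]; simpa using hl2
  · rw [abs_of_nonpos h1]
    refine le_trans (le_of_eq ?_) hl1
    rw [mul_comm]; ring_nf

/-- The denominator of the kernel, divided by `u`, does not vanish between the poles `-1` and `1`. -/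
theorem dslope_exp_ne_zero {u : ℂ} (hu : u.re ∈ Set.Ioo (-1 : ℝ) 1) :
    dslope (fun u : ℂ => exp (2 * Real.pi * I * u)) 0 u ≠ 0 := by
  have hpi : (2 * Real.pi * I : ℂ) ≠ 0 := by simp [Real.pi_ne_zero]
  rcases eq_or_ne u 0 with rfl | h0
  · have hd : HasDerivAt (fun u : ℂ => exp (2 * Real.pi * I * u)) (2 * Real.pi * I) 0 := by
      simpa using ((hasDerivAt_id (0 : ℂ)).const_mul (2 * Real.pi * I)).cexp
    rw [dslope_same, hd.deriv]
    exact hpi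
  · rw [dslope_of_ne _ h0, slope_def_field]
    refine div_ne_zero ?_ (by simpa using h0)
    intro h
    rw [mul_zero, exp_zero, sub_eq_zero, exp_eq_one_iff] at h
    obtain ⟨m, hm⟩ := h
    have hum : u = m := mul_left_cancel₀ hpi (by rw [hm]; ring)
    rw [hum] at hu h0
    simp only [intCast_re, Set.mem_Ioo] at hu
    have h1 : (-1 : ℤ) < m := by exact_mod_cast hu.1
    have h2 : m < 1 := by exact_mod_cast hu.2
    have : m = 0 := by omega
    simp [this] at h0

/-- The integrand of the Lindelöf integral in terms of its growth. -/
theorem norm_mul_kernel_mul_exp_le {p k ζ w : ℂ} {β b K H : ℝ} (hK0 : 0 ≤ K)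
    (hp : ‖p‖ ≤ K * Real.exp (β * |ζ.im| + b * ζ.re))
    (hk : ‖k‖ ≤ H * Real.exp (Real.pi * (ζ.im - |ζ.im|))) :
    ‖p * (k * exp (ζ * w))‖ ≤ K * H * Real.exp ((b + w.re) * ζ.re) *
      Real.exp (-((Real.pi - β - |w.im - Real.pi|) * |ζ.im|)) := by
  have hH : 0 ≤ H * Real.exp (Real.pi * (ζ.im - |ζ.im|)) := (norm_nonneg _).trans hk
  have hH0 : 0 ≤ H := nonneg_of_mul_nonneg_left hH (Real.exp_pos _)
  rw [norm_mul, norm_mul, norm_exp]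
  calc ‖p‖ * (‖k‖ * Real.exp (ζ * w).re)
      ≤ (K * Real.exp (β * |ζ.im| + b * ζ.re)) *
        ((H * Real.exp (Real.pi * (ζ.im - |ζ.im|))) * Real.exp (ζ * w).re) := by gcongr
    _ = K * H * Real.exp ((β * |ζ.im| + b * ζ.re) + (Real.pi * (ζ.im - |ζ.im|)) + (ζ * w).re) := by
        rw [Real.exp_add (_ + _) (ζ * w).re, Real.exp_add (_ + _) (Real.pi * _)]; ring
    _ ≤ K * H * Real.exp ((b + w.re) * ζ.re +
        -((Real.pi - β - |w.im - Real.pi|) * |ζ.im|)) := by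
        refine mul_le_mul_of_nonneg_left (Real.exp_le_exp.2 ?_) (by positivity)
        rw [mul_re]
        have h1 : -(ζ.im * (w.im - Real.pi)) ≤ |w.im - Real.pi| * |ζ.im| := by
          rw [mul_comm, ← abs_mul]
          exact neg_le_abs _
        nlinarith
    _ = _ := by rw [Real.exp_add]; ring

theorem exp_neg_mul_abs_le {s : ℝ} (hs : 0 < s) (t : ℝ) :
    Real.exp (-(s * |t|)) ≤ (1 + 2 / s ^ 2) * (1 + t ^ 2)⁻¹ := by
  have h := Real.quadratic_le_exp_of_nonneg (x := s * |t|) (by positivity)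
  rw [mul_pow, sq_abs] at h
  rw [Real.exp_neg, ← div_eq_mul_inv, ← one_div, div_le_div_iff₀ (Real.exp_pos _) (by positivity)]
  have h1 : 0 ≤ s * |t| := by positivity
  have h2 : (1 + 2 / s ^ 2) * (1 + s ^ 2 * t ^ 2 / 2) ≤ (1 + 2 / s ^ 2) * Real.exp (s * |t|) := by
    gcongr; linarith
  have h3 : (1 + 2 / s ^ 2) * (1 + s ^ 2 * t ^ 2 / 2) =
      1 + 2 / s ^ 2 + s ^ 2 * t ^ 2 / 2 + t ^ 2 := by
    field_simp; ring
  have : 0 ≤ 2 / s ^ 2 + s ^ 2 * t ^ 2 / 2 := by positivity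
  linarith

/-- Moving the line of integration across one pole picks up one term of the power series. -/
theorem integral_line_sub_integral_line {ψ : ℂ → ℂ} {β b K c : ℝ}
    (hc : c ∈ Set.Ioo (0 : ℝ) (1 / 4)) (hK0 : 0 ≤ K)
    (hψ : ∀ ζ : ℂ, 0 ≤ ζ.re → DifferentiableAt ℂ ψ ζ)
    (hb : ∀ ζ : ℂ, 0 ≤ ζ.re → ‖ψ ζ‖ ≤ K * Real.exp (β * |ζ.im| + b * ζ.re))
    {w : ℂ} (hw : |w.im - Real.pi| < Real.pi - β) (m : ℕ)
    {Q : ℂ → ℂ} (hQ : Q = fun ζ => ψ ζ * (I / (1 - exp (2 * Real.pi * I * ζ)) * exp (ζ * w))) :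
    (∫ t : ℝ, Q ((m + c : ℝ) + t * I)) - ∫ t : ℝ, Q ((m + 1 + c : ℝ) + t * I) =
      ψ (m + 1 : ℕ) * exp ((m + 1 : ℕ) * w) := by
  set s := Real.pi - β - |w.im - Real.pi| with hs
  have hspos : 0 < s := by linarith
  set N : ℂ → ℂ := fun u => ψ ((m + 1 : ℕ) + u) *
    (-I * (dslope (fun u : ℂ => exp (2 * Real.pi * I * u)) 0 u)⁻¹ *
      exp (((m + 1 : ℕ) + u) * w)) with hN
  have hper : ∀ u : ℂ, exp (2 * Real.pi * I * ((m + 1 : ℕ) + u)) = exp (2 * Real.pi * I * u) := by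
    intro u
    rw [mul_add, exp_add, show (2 * Real.pi * I * (m + 1 : ℕ) : ℂ) = (m + 1 : ℕ) * (2 * Real.pi * I)
      by ring, exp_nat_mul_two_pi_mul_I, one_mul]
  have hNQ : ∀ u : ℂ, u ≠ 0 → N u / u = Q ((m + 1 : ℕ) + u) := by
    intro u hu
    simp only [hN, hQ, hper]
    rw [dslope_of_ne _ hu, slope_def_field, mul_zero, exp_zero, sub_zero, inv_div,
      ← neg_sub 1 (exp _), div_neg, div_eq_mul_inv I, div_eq_mul_inv u]
    field_simp
  have hre : ∀ u : ℂ, u.re ∈ Set.Ioo (-1 : ℝ) 1 → 0 ≤ (((m + 1 : ℕ) : ℂ) + u).re := by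
    intro u hu
    have : (0 : ℝ) ≤ m := Nat.cast_nonneg m
    simp only [add_re, natCast_re]
    push_cast
    linarith [hu.1]
  have hNd : DifferentiableOn ℂ N (re ⁻¹' Set.Ioo (-1) 1) := by
    intro u hu
    have h1 : DifferentiableAt ℂ (fun u : ℂ => ψ ((m + 1 : ℕ) + u)) u :=
      (hψ _ (hre u hu)).comp u (by fun_prop)
    have h2 : DifferentiableAt ℂ (dslope (fun u : ℂ => exp (2 * Real.pi * I * u)) 0) u :=
      ((Complex.differentiableOn_dslope univ_mem).2
        (Differentiable.differentiableOn (by fun_prop))).differentiableAt univ_mem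
    have h3 := h2.inv (dslope_exp_ne_zero hu)
    exact (h1.mul ((h3.const_mul _).mul (by fun_prop))).differentiableWithinAt
  have hc1 : c ∈ Set.Ioo (0 : ℝ) 1 := ⟨hc.1, by linarith [hc.2]⟩
  obtain ⟨M, hM⟩ : ∃ M : ℝ, ∀ x ∈ Set.Icc (c - 1) c,
      Real.exp ((b + w.re) * (m + 1 + x)) ≤ M := by
    obtain ⟨M, hM⟩ := (isCompact_Icc (a := c - 1) (b := c)).exists_bound_of_continuousOn
      (f := fun x : ℝ => Real.exp ((b + w.re) * (m + 1 + x)))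
      (Continuous.continuousOn (by fun_prop))
    exact ⟨M, fun x hx => (le_abs_self _).trans (hM x hx)⟩
  have hres := integral_vertical_sub_of_simple_pole (N := N)
    (K := K * 2 * M * (1 + 2 / s ^ 2)) hc1 hNd (by
      intro u hu hu1
      have hu0 : u ≠ 0 := by rintro rfl; simp at hu1; linarith
      have huS : u.re ∈ Set.Ioo (-1 : ℝ) 1 :=
        ⟨by linarith [hu.1, hc.1], by linarith [hu.2, hc.2]⟩
      have himu : (((m + 1 : ℕ) : ℂ) + u).im = u.im := by simp
      have hreu : (((m + 1 : ℕ) : ℂ) + u).re = m + 1 + u.re := by simp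
      rw [hNQ u hu0, hQ]
      have h := norm_mul_kernel_mul_exp_le (w := w) hK0 (hb _ (hre u huS))
        (norm_kernel_le_of_one_le (by rw [himu]; exact hu1))
      rw [himu, hreu, ← hs] at h
      refine h.trans ?_
      rw [mul_assoc _ (1 + 2 / s ^ 2)]
      have hM0 : 0 ≤ M := (Real.exp_pos _).le.trans (hM _ hu)
      exact mul_le_mul (mul_le_mul_of_nonneg_left (hM _ hu) (by positivity))
        (exp_neg_mul_abs_le hspos _) (Real.exp_pos _).le (by positivity))
  have hne : ∀ a : ℝ, a ≠ 0 → ∀ t : ℝ, (a : ℂ) + t * I ≠ 0 := fun a ha t h => ha (by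
    have := congrArg re h; simpa using this)
  have hl : ∀ a : ℝ, a ≠ 0 → ∀ t : ℝ, N (a + t * I) / (a + t * I) =
      Q ((m + 1 + a : ℝ) + t * I) := by
    intro a ha t
    rw [hNQ _ (hne a ha t)]
    push_cast
    ring_nf
  simp only [hl c hc.1.ne', hl (c - 1) (by linarith [hc.2] : c - 1 < 0).ne] at hres
  have hN0 : N 0 = -(ψ (m + 1 : ℕ) * exp ((m + 1 : ℕ) * w)) / (2 * Real.pi) := by
    have hd : HasDerivAt (fun u : ℂ => exp (2 * Real.pi * I * u)) (2 * Real.pi * I) 0 := by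
      simpa using ((hasDerivAt_id (0 : ℂ)).const_mul (2 * Real.pi * I)).cexp
    simp only [hN, add_zero, dslope_same, hd.deriv]
    have : (Real.pi : ℂ) ≠ 0 := by simp [Real.pi_ne_zero]
    field_simp
  rw [hN0, show ((m : ℝ) + 1 + (c - 1)) = m + c by ring] at hres
  have : (Real.pi : ℂ) ≠ 0 := by simp [Real.pi_ne_zero]
  rw [mul_div_cancel₀ _ (by simp)] at hres
  linear_combination -hres

/-- A bound for the kernel on the support of `contourMeasure c`. -/
noncomputable def kernelBound (c : ℝ) : ℝ := max 1 (Real.sin (2 * Real.pi * c))⁻¹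

theorem kernelBound_pos (c : ℝ) : 0 < kernelBound c := lt_of_lt_of_le one_pos (le_max_left _ _)

theorem norm_kernel_le {ζ : ℂ} {c : ℝ} (hc : c ∈ Set.Ioo (0 : ℝ) (1 / 4))
    (h : ζ = 0 ∨ ζ.re = c) :
    ‖kernel ζ‖ ≤ kernelBound c * Real.exp (Real.pi * (ζ.im - |ζ.im|)) := by
  unfold kernel kernelBound
  split_ifs with h0
  · simp [h0]
  · have := norm_kernel_le_of_re_eq hc (m := 0) (by simpa using h.resolve_left h0)
    exact this.trans (mul_le_mul_of_nonneg_right (le_max_right _ _) (Real.exp_pos _).le)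

theorem re_mem_Icc_of_mem_contour {ζ : ℂ} {c : ℝ} (hc : 0 ≤ c) (h : ζ = 0 ∨ ζ.re = c) :
    ζ.re ∈ Set.Icc 0 c := by
  rcases h with rfl | h
  · simpa using hc
  · rw [h]; exact ⟨hc, le_rfl⟩

/-- The one-variable Lindelöf representation: for small `z = e^w` near the negative real axis, the
contour integral of `ψ(ζ) e^{ζw}` against the kernel is the sum of the series `∑ ψ(k) e^{kw}`. -/
theorem hasSum_integral_kernel {ψ : ℂ → ℂ} {β b K c : ℝ}
    (hc : c ∈ Set.Ioo (0 : ℝ) (1 / 4)) (hK0 : 0 ≤ K)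
    (hψ : ∀ ζ : ℂ, 0 ≤ ζ.re → DifferentiableAt ℂ ψ ζ)
    (hb : ∀ ζ : ℂ, 0 ≤ ζ.re → ‖ψ ζ‖ ≤ K * Real.exp (β * |ζ.im| + b * ζ.re))
    {w : ℂ} (hw : |w.im - Real.pi| < Real.pi - β) (hwb : w.re < -b) :
    HasSum (fun k : ℕ => ψ k * exp (k * w))
      (∫ ζ, ψ ζ * (kernel ζ * exp (ζ * w)) ∂contourMeasure c) := by
  set s := Real.pi - β - |w.im - Real.pi| with hs
  have hspos : 0 < s := by linarith
  obtain ⟨Q, hQ⟩ : ∃ Q : ℂ → ℂ,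
    Q = fun ζ => ψ ζ * (I / (1 - exp (2 * Real.pi * I * ζ)) * exp (ζ * w)) := ⟨_, rfl⟩
  have hre : ∀ (m : ℕ) (t : ℝ), (((m + c : ℝ) : ℂ) + t * I).re = m + c := fun m t => by simp
  have him : ∀ (m : ℕ) (t : ℝ), (((m + c : ℝ) : ℂ) + t * I).im = t := fun m t => by simp
  have hnn : ∀ m : ℕ, (0 : ℝ) ≤ m + c := fun m => by have := hc.1; positivity
  -- the integrals over the shifted lines tend to zero
  have hbound : ∀ (m : ℕ) (t : ℝ), ‖Q ((m + c : ℝ) + t * I)‖ ≤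
      K * kernelBound c * Real.exp ((b + w.re) * (m + c)) * Real.exp (-(s * |t|)) := by
    intro m t
    have h := norm_mul_kernel_mul_exp_le (w := w) (ζ := (m + c : ℝ) + t * I) (b := b) hK0
      (hb _ (by rw [hre]; exact hnn m))
      ((norm_kernel_le_of_re_eq hc (hre m t)).trans
        (mul_le_mul_of_nonneg_right (le_max_right 1 _) (Real.exp_pos _).le))
    rw [hre, him] at h
    rw [hQ]
    exact h
  set J : ℕ → ℂ := fun m => ∫ t : ℝ, Q ((m + c : ℝ) + t * I) with hJ
  have hstep : ∀ m : ℕ, J m - J (m + 1) = ψ (m + 1 : ℕ) * exp ((m + 1 : ℕ) * w) := by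
    intro m
    have := integral_line_sub_integral_line hc hK0 hψ hb hw m hQ
    rw [← this]
    simp only [hJ]
    push_cast
    rfl
  set x := Real.exp (b + w.re) with hx
  have hx1 : x < 1 := by rw [hx, Real.exp_lt_one_iff]; linarith
  have hx0 : 0 ≤ x := (Real.exp_pos _).le
  have hJle : ∀ m : ℕ, ‖J m‖ ≤ (K * kernelBound c * Real.exp ((b + w.re) * c) *
      ∫ t : ℝ, Real.exp (-(s * |t|))) * x ^ m := by
    intro m
    have h1 := norm_integral_le_of_norm_le ((integrable_exp_neg_mul_abs hspos).const_mul
      (K * kernelBound c * Real.exp ((b + w.re) * (m + c)))) (Eventually.of_forall (hbound m))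
    refine h1.trans (le_of_eq ?_)
    rw [integral_const_mul, hx, ← Real.exp_nat_mul, mul_add, Real.exp_add]
    ring_nf
  have hJ0 : Tendsto J atTop (𝓝 0) := by
    refine squeeze_zero_norm hJle ?_
    simpa using (tendsto_pow_atTop_nhds_zero_of_lt_one hx0 hx1).const_mul _
  have hsum : Summable fun k : ℕ => ψ k * exp (k * w) := by
    refine Summable.of_norm_bounded ((summable_geometric_of_lt_one hx0 hx1).mul_left K) fun k => ?_
    have h := hb k (by simp)
    rw [norm_mul, norm_exp, hx, ← Real.exp_nat_mul]
    simp only [natCast_im, abs_zero, mul_zero, zero_add, natCast_re, mul_re, zero_mul,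
      sub_zero] at h ⊢
    calc ‖ψ k‖ * Real.exp (k * w.re) ≤ K * Real.exp (b * k) * Real.exp (k * w.re) := by gcongr
      _ = _ := by rw [mul_assoc, ← Real.exp_add]; ring_nf
  have htot : HasSum (fun k : ℕ => ψ k * exp (k * w)) (ψ 0 + J 0) := by
    rw [hsum.hasSum_iff_tendsto_nat, ← tendsto_add_atTop_iff_nat 1]
    have hpart : ∀ m : ℕ, ∑ k ∈ Finset.range (m + 1), ψ k * exp (k * w) = ψ 0 + (J 0 - J m) := by
      intro m
      rw [Finset.sum_range_succ', ← Finset.sum_range_sub' J m]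
      simp only [hstep]
      simp [add_comm]
    simp only [hpart]
    simpa using ((hJ0.const_sub (J 0)).const_add (ψ 0))
  have hker : ∀ t : ℝ, ψ (c + t * I) * (kernel (c + t * I) * exp ((c + t * I) * w)) =
      Q (((0 : ℕ) + c : ℝ) + t * I) := by
    intro t
    have h0 : (c : ℂ) + t * I ≠ 0 := fun h => hc.1.ne' (by
      have := congrArg re h; simpa using this)
    simp [kernel, h0, hQ]
  have hcont : ContinuousOn ψ {ζ | 0 ≤ ζ.re} := fun ζ hζ =>
    (hψ ζ hζ).continuousAt.continuousWithinAt
  have hint : Integrable (fun ζ => ψ ζ * (kernel ζ * exp (ζ * w))) (contourMeasure c) := by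
    rw [integrable_contourMeasure_iff]
    refine ((integrable_exp_neg_mul_abs hspos).const_mul
      (K * kernelBound c * Real.exp ((b + w.re) * ((0 : ℕ) + c)))).mono' ?_
      (Eventually.of_forall fun t => by rw [hker]; exact hbound 0 t)
    refine AEStronglyMeasurable.mul (Continuous.aestronglyMeasurable ?_) ?_
    · rw [← continuousOn_univ]
      exact hcont.comp (by fun_prop) fun t _ => by simpa using hc.1.le
    · exact ((measurable_kernel.comp (measurable_line c)).mul (by fun_prop)).aestronglyMeasurable
  rw [integral_contourMeasure hint]
  simp only [hker]
  simpa [kernel, hJ] using htot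

/-! ### The Lindelöf representation in several variables -/

/-- The product of the one-variable contour measures. -/
noncomputable def contourMeasurePi (n : ℕ) (c : ℝ) : Measure (Fin n → ℂ) :=
  Measure.pi fun _ => contourMeasure c

/-- The Lindelöf integral
`∫ φ(ζ) ∏ⱼ kernel(ζⱼ) e^{ζⱼ wⱼ}` over the product of the contours, in logarithmic coordinates
`z = e^w`. -/
noncomputable def lindelofIntegral {n : ℕ} (φ : (Fin n → ℂ) → ℂ) (c : ℝ) (w : Fin n → ℂ) : ℂ :=
  ∫ ζ, φ ζ * ∏ j, (kernel (ζ j) * exp (ζ j * w j)) ∂contourMeasurePi n c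

instance (n : ℕ) (c : ℝ) : SigmaFinite (contourMeasurePi n c) := by
  unfold contourMeasurePi; infer_instance

theorem ae_contourMeasurePi (n : ℕ) (c : ℝ) :
    ∀ᵐ ζ ∂contourMeasurePi n c, ∀ j, ζ j = 0 ∨ (ζ j).re = c :=
  eventually_all.2 fun j =>
    (Measure.tendsto_eval_ae_ae (μ := fun _ : Fin n => contourMeasure c) (i := j)).eventually
      (ae_contourMeasure c)

theorem aestronglyMeasurable_of_continuousOn {n : ℕ} {φ : (Fin n → ℂ) → ℂ} {c : ℝ} (hc : 0 ≤ c)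
    (hφ : ContinuousOn φ (closedRightDomain n)) :
    AEStronglyMeasurable φ (contourMeasurePi n c) := by
  have hcl : IsClosed (closedRightDomain n) := by
    simp only [closedRightDomain, Set.ofPred_forall]
    exact isClosed_iInter fun j => isClosed_le continuous_const (by fun_prop)
  have h := hφ.aestronglyMeasurable (μ := contourMeasurePi n c) hcl.measurableSet
  rwa [Measure.restrict_eq_self_of_ae_mem] at h
  filter_upwards [ae_contourMeasurePi n c] with ζ hζ j
  exact (re_mem_Icc_of_mem_contour hc (hζ j)).1

theorem measurable_prod_kernel {n : ℕ} (w : Fin n → ℂ) :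
    Measurable fun ζ : Fin n → ℂ => ∏ j, (kernel (ζ j) * exp (ζ j * w j)) :=
  Finset.measurable_fun_prod _ fun j _ =>
    (measurable_kernel.comp (measurable_pi_apply j)).mul (by fun_prop)

theorem summable_prod_pi : ∀ {n : ℕ} {g : Fin n → ℕ → ℝ}, (∀ j k, 0 ≤ g j k) →
    (∀ j, Summable (g j)) → Summable fun k : Fin n → ℕ => ∏ j, g j (k j)
  | 0, _, _, _ => Summable.of_finite
  | n + 1, g, h0, hg => by
    rw [← (Fin.consEquiv fun _ => ℕ).summable_iff]
    have := (hg 0).mul_of_nonneg (summable_prod_pi (fun j => h0 j.succ) fun j => hg j.succ)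
      (fun k => h0 0 k) (fun k => Finset.prod_nonneg fun j _ => h0 _ _)
    refine this.congr fun p => ?_
    simp [Fin.prod_univ_succ]

section

variable {β b c : ℝ}

theorem summable_of_norm_le {n : ℕ} {φ : (Fin n → ℂ) → ℂ} {K : ℝ}
    (hb : ∀ ζ ∈ closedRightDomain n,
      ‖φ ζ‖ ≤ K * ∏ j, Real.exp (β * |(ζ j).im| + b * (ζ j).re))
    {w : Fin n → ℂ} (hwb : ∀ j, (w j).re < -b) :
    Summable fun k : Fin n → ℕ => φ (fun j => k j) * ∏ j, exp (k j * w j) := by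
  refine Summable.of_norm_bounded ((summable_prod_pi (g := fun j k => Real.exp (b + (w j).re) ^ k)
    (fun _ _ => by positivity)
    fun j => summable_geometric_of_lt_one (Real.exp_pos _).le
      (by rw [Real.exp_lt_one_iff]; linarith [hwb j])).mul_left K) fun k => ?_
  have h := hb (fun j => k j) fun j => by simp
  rw [norm_mul, norm_prod]
  refine (mul_le_mul_of_nonneg_right h (by positivity)).trans (le_of_eq ?_)
  rw [mul_assoc, ← Finset.prod_mul_distrib]
  congr 1
  refine Finset.prod_congr rfl fun j _ => ?_
  rw [norm_exp, ← Real.exp_add, ← Real.exp_nat_mul]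
  simp
  ring

theorem integrable_lindelof {n : ℕ} {φ : (Fin n → ℂ) → ℂ} {K : ℝ}
    (hc : c ∈ Set.Ioo (0 : ℝ) (1 / 4))
    (hφ : ∀ ζ ∈ closedRightDomain n, DifferentiableAt ℂ φ ζ) (hK0 : 0 ≤ K)
    (hb : ∀ ζ ∈ closedRightDomain n,
      ‖φ ζ‖ ≤ K * ∏ j, Real.exp (β * |(ζ j).im| + b * (ζ j).re))
    {w : Fin n → ℂ} (hw : ∀ j, |(w j).im - Real.pi| < Real.pi - β) (hwb : ∀ j, (w j).re < -b) :
    Integrable (fun ζ => φ ζ * ∏ j, (kernel (ζ j) * exp (ζ j * w j))) (contourMeasurePi n c) := by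
  have hg : Integrable (fun ζ : Fin n → ℂ => K * ∏ j, (kernelBound c *
      Real.exp (-((Real.pi - β - |(w j).im - Real.pi|) * |(ζ j).im|)))) (contourMeasurePi n c) := by
    refine Integrable.const_mul ?_ K
    exact Integrable.fintype_prod (f := fun j (z : ℂ) => kernelBound c *
      Real.exp (-((Real.pi - β - |(w j).im - Real.pi|) * |z.im|))) fun j =>
        (integrable_exp_neg_mul_abs_im c (by linarith [hw j])).const_mul _
  refine hg.mono' ((aestronglyMeasurable_of_continuousOn hc.1.le fun ζ hζ =>
    (hφ ζ hζ).continuousAt.continuousWithinAt).mul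
      (measurable_prod_kernel w).aestronglyMeasurable) ?_
  filter_upwards [ae_contourMeasurePi n c] with ζ hζ
  have h := hb ζ fun j => (re_mem_Icc_of_mem_contour hc.1.le (hζ j)).1
  rw [norm_mul, norm_prod]
  refine (mul_le_mul_of_nonneg_right h (by positivity)).trans ?_
  rw [mul_assoc, ← Finset.prod_mul_distrib]
  refine mul_le_mul_of_nonneg_left (Finset.prod_le_prod (fun _ _ => by positivity)
    fun j _ => ?_) hK0
  have h1 := norm_mul_kernel_mul_exp_le (p := ((Real.exp (β * |(ζ j).im| + b * (ζ j).re) : ℝ) : ℂ))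
    (β := β) (b := b) (w := w j) zero_le_one (by
    rw [norm_real, Real.norm_of_nonneg (Real.exp_pos _).le, one_mul])
    (norm_kernel_le hc (hζ j))
  rw [norm_mul, norm_real, Real.norm_of_nonneg (Real.exp_pos _).le, one_mul] at h1
  refine h1.trans ?_
  have h2 : Real.exp ((b + (w j).re) * (ζ j).re) ≤ 1 := by
    rw [Real.exp_le_one_iff]
    have := (re_mem_Icc_of_mem_contour hc.1.le (hζ j)).1
    nlinarith [hwb j]
  refine mul_le_mul_of_nonneg_right ?_ (Real.exp_pos _).le
  exact mul_le_of_le_one_right (kernelBound_pos c).le h2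

theorem cons_mem_closedRightDomain {n : ℕ} {x : ℂ} {y : Fin n → ℂ} (hx : 0 ≤ x.re)
    (hy : y ∈ closedRightDomain n) : (Fin.cons x y : Fin (n + 1) → ℂ) ∈ closedRightDomain (n + 1) :=
  fun j => Fin.cases (by simpa using hx) (fun i => by simpa using hy i) j

/-- Near the origin, in the directions where every `zⱼ` is close to the negative real axis, the
Lindelöf integral is the sum of the power series. By induction on the number of variables and
Fubini's theorem. -/
theorem lindelofIntegral_eq_tsum (hc : c ∈ Set.Ioo (0 : ℝ) (1 / 4)) :
    ∀ {n : ℕ} {φ : (Fin n → ℂ) → ℂ} {K : ℝ},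
    (∀ ζ ∈ closedRightDomain n, DifferentiableAt ℂ φ ζ) → 0 ≤ K →
    (∀ ζ ∈ closedRightDomain n, ‖φ ζ‖ ≤ K * ∏ j, Real.exp (β * |(ζ j).im| + b * (ζ j).re)) →
    ∀ {w : Fin n → ℂ}, (∀ j, |(w j).im - Real.pi| < Real.pi - β) → (∀ j, (w j).re < -b) →
    lindelofIntegral φ c w = ∑' k : Fin n → ℕ, φ (fun j => k j) * ∏ j, exp (k j * w j)
  | 0, φ, K, _, _, _, w, _, _ => by
    unfold lindelofIntegral contourMeasurePi
    rw [Measure.pi_of_empty _ (0 : Fin 0 → ℂ), integral_dirac, tsum_eq_single 0]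
    · simp only [Finset.univ_eq_empty, Finset.prod_empty, mul_one]
      congr 1
      exact Subsingleton.elim _ _
    · intro k hk
      exact absurd (Subsingleton.elim _ _) hk
  | n + 1, φ, K, hφ, hK0, hb, w, hw, hwb => by
    have hint := integrable_lindelof hc hφ hK0 hb hw hwb
    have hsum := summable_of_norm_le hb hwb
    set F : (Fin (n + 1) → ℂ) → ℂ := fun ζ => φ ζ * ∏ j, (kernel (ζ j) * exp (ζ j * w j)) with hF
    have hmp := (measurePreserving_piFinSuccAbove (fun _ : Fin (n + 1) => contourMeasure c) 0).symm
    have hconsd : ∀ x : ℂ, Differentiable ℂ fun y : Fin n → ℂ => (Fin.cons x y : Fin (n + 1) → ℂ) :=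
      fun x => differentiable_pi.2 fun j => Fin.cases (by simp) (fun i => by
        simpa using differentiable_apply i) j
    have hconsd' : ∀ y : Fin n → ℂ, Differentiable ℂ fun x : ℂ => (Fin.cons x y : Fin (n + 1) → ℂ) :=
      fun y => differentiable_pi.2 fun j => Fin.cases (by simp) (fun i => by simp) j
    have hnorm : ∀ x : ℂ, 0 ≤ x.re → ∀ y ∈ closedRightDomain n, ‖φ (Fin.cons x y)‖ ≤
        (K * Real.exp (β * |x.im| + b * x.re)) *
          ∏ j, Real.exp (β * |(y j).im| + b * (y j).re) := by
      intro x hx y hy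
      have := hb _ (cons_mem_closedRightDomain hx hy)
      rw [Fin.prod_univ_succ] at this
      simpa [mul_assoc] using this
    have hfub : lindelofIntegral φ c w = ∫ x, ∫ y, F (Fin.cons x y) ∂contourMeasurePi n c
        ∂contourMeasure c := by
      have h1 := hmp.integral_comp' (g := F)
      have h2 : Integrable (F ∘ (MeasurableEquiv.piFinSuccAbove (fun _ => ℂ) 0).symm)
          ((contourMeasure c).prod (contourMeasurePi n c)) :=
        (hmp.integrable_comp_emb (MeasurableEquiv.measurableEmbedding _)).2 hint
      unfold lindelofIntegral contourMeasurePi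
      rw [← h1]
      have hsymm : ∀ (x : ℂ) (y : Fin n → ℂ),
          (MeasurableEquiv.piFinSuccAbove (fun _ => ℂ) 0).symm (x, y) = Fin.cons x y :=
        fun x y => Fin.insertNth_zero' x y
      refine (integral_prod _ h2).trans ?_
      simp only [Function.comp_apply, hsymm]
      rfl
    have hnat : ∀ k : Fin n → ℕ, (fun j => (k j : ℂ)) ∈ closedRightDomain n := fun k j => by simp
    -- the inner integral, by the inductive hypothesis
    have hinner : ∀ᵐ x ∂contourMeasure c, ∫ y, F (Fin.cons x y) ∂contourMeasurePi n c =
        ∑' k : Fin n → ℕ, (φ (Fin.cons x fun j => (k j : ℂ)) * (kernel x * exp (x * w 0))) *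
          ∏ j, exp (k j * w j.succ) := by
      filter_upwards [ae_contourMeasure c] with x hx
      have hx0 := (re_mem_Icc_of_mem_contour hc.1.le hx).1
      have ih := lindelofIntegral_eq_tsum hc (φ := fun y => φ (Fin.cons x y))
        (K := K * Real.exp (β * |x.im| + b * x.re))
        (fun y hy => (hφ _ (cons_mem_closedRightDomain hx0 hy)).comp y (hconsd x).differentiableAt)
        (by positivity) (hnorm x hx0) (w := fun j => w j.succ) (fun j => hw j.succ)
        (fun j => hwb j.succ)
      have h1 : ∀ y : Fin n → ℂ, F (Fin.cons x y) = (kernel x * exp (x * w 0)) *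
          (φ (Fin.cons x y) * ∏ j, (kernel (y j) * exp (y j * w j.succ))) := by
        intro y
        simp only [hF, Fin.prod_univ_succ, Fin.cons_zero, Fin.cons_succ]
        ring
      simp only [h1]
      rw [integral_const_mul]
      unfold lindelofIntegral at ih
      rw [ih, ← tsum_mul_left]
      exact tsum_congr fun k => by ring
    set s := Real.pi - β - |(w 0).im - Real.pi| with hs
    have hspos : 0 < s := by linarith [hw 0]
    set g : (Fin n → ℕ) → ℝ := fun k => ∏ j, Real.exp (b + (w (Fin.succ j)).re) ^ k j with hg
    have hgsum : Summable g := summable_prod_pi (g := fun j k => Real.exp (b + (w j.succ).re) ^ k)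
      (fun _ _ => by positivity)
      fun j => summable_geometric_of_lt_one (Real.exp_pos _).le
        (by rw [Real.exp_lt_one_iff]; linarith [hwb j.succ])
    have hterm : ∀ k : Fin n → ℕ, ∀ᵐ x ∂contourMeasure c,
        ‖(φ (Fin.cons x fun j => (k j : ℂ)) * (kernel x * exp (x * w 0))) *
          ∏ j, exp (k j * w j.succ)‖ ≤ K * kernelBound c * g k * Real.exp (-(s * |x.im|)) := by
      intro k
      filter_upwards [ae_contourMeasure c] with x hx
      have hx0 := (re_mem_Icc_of_mem_contour hc.1.le hx).1
      have h1 := hnorm x hx0 _ (hnat k)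
      rw [mul_right_comm] at h1
      have h2 := norm_mul_kernel_mul_exp_le (w := w 0) (by positivity) h1 (norm_kernel_le hc hx)
      rw [norm_mul, norm_prod]
      refine (mul_le_mul_of_nonneg_right h2 (by positivity)).trans ?_
      have h3 : Real.exp ((b + (w 0).re) * x.re) ≤ 1 := by
        rw [Real.exp_le_one_iff]
        nlinarith [hwb 0]
      have h4 : (∏ j, Real.exp (β * |((k j : ℂ)).im| + b * ((k j : ℂ)).re)) *
          ∏ j, ‖exp (k j * w j.succ)‖ = g k := by
        rw [hg, ← Finset.prod_mul_distrib]
        refine Finset.prod_congr rfl fun j _ => ?_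
        rw [norm_exp, ← Real.exp_add, ← Real.exp_nat_mul]
        simp
        ring
      have hH := kernelBound_pos c
      have hgk : 0 ≤ g k := Finset.prod_nonneg fun j _ => by positivity
      calc _ = K * ((∏ j, Real.exp (β * |((k j : ℂ)).im| + b * ((k j : ℂ)).re)) *
          ∏ j, ‖exp (k j * w j.succ)‖) * kernelBound c * Real.exp ((b + (w 0).re) * x.re) *
          Real.exp (-(s * |x.im|)) := by ring
        _ ≤ K * g k * kernelBound c * 1 * Real.exp (-(s * |x.im|)) := by
          rw [h4]; gcongr
        _ = _ := by ring
    have hmeas : ∀ k : Fin n → ℕ, AEStronglyMeasurable (fun x =>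
        (φ (Fin.cons x fun j => (k j : ℂ)) * (kernel x * exp (x * w 0))) *
          ∏ j, exp (k j * w j.succ)) (contourMeasure c) := by
      intro k
      refine AEStronglyMeasurable.mul (AEStronglyMeasurable.mul ?_
        (measurable_kernel.mul (by fun_prop)).aestronglyMeasurable) aestronglyMeasurable_const
      have hcl : MeasurableSet {x : ℂ | 0 ≤ x.re} := measurableSet_le measurable_const measurable_re
      have h := ContinuousOn.aestronglyMeasurable (μ := contourMeasure c)
        (f := fun x => φ (Fin.cons x fun j => (k j : ℂ))) (s := {x : ℂ | 0 ≤ x.re})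
        (fun x hx => ((hφ _ (cons_mem_closedRightDomain hx (hnat k))).comp x
          (hconsd' _).differentiableAt).continuousAt.continuousWithinAt) hcl
      rwa [Measure.restrict_eq_self_of_ae_mem] at h
      filter_upwards [ae_contourMeasure c] with x hx
      exact (re_mem_Icc_of_mem_contour hc.1.le hx).1
    have hintk : ∀ k : Fin n → ℕ, Integrable (fun x =>
        (φ (Fin.cons x fun j => (k j : ℂ)) * (kernel x * exp (x * w 0))) *
          ∏ j, exp (k j * w j.succ)) (contourMeasure c) := fun k =>
      ((integrable_exp_neg_mul_abs_im c hspos).const_mul _).mono' (hmeas k) (hterm k)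
    have hswap := integral_tsum_of_summable_integral_norm hintk (by
      refine Summable.of_nonneg_of_le (fun k => integral_nonneg fun x => norm_nonneg _)
        (fun k => integral_mono_ae (hintk k).norm
          ((integrable_exp_neg_mul_abs_im c hspos).const_mul _) (hterm k)) ?_
      simp only [integral_const_mul]
      exact (hgsum.mul_left _).mul_right _)
    -- the outer integral, by the representation in one variable
    have houter : ∀ k : Fin n → ℕ, ∫ x, (φ (Fin.cons x fun j => (k j : ℂ)) *
        (kernel x * exp (x * w 0))) * ∏ j, exp (k j * w j.succ) ∂contourMeasure c =
        ∑' m : ℕ, φ (Fin.cons (m : ℂ) fun j => (k j : ℂ)) *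
          (exp (m * w 0) * ∏ j, exp (k j * w j.succ)) := by
      intro k
      rw [integral_mul_const]
      have h := hasSum_integral_kernel (ψ := fun x => φ (Fin.cons x fun j => (k j : ℂ)))
        (β := β) (b := b) (K := K * ∏ j, Real.exp (β * |((k j : ℂ)).im| + b * ((k j : ℂ)).re))
        (c := c) hc (by positivity)
        (fun x hx => (hφ _ (cons_mem_closedRightDomain hx (hnat k))).comp x
          (hconsd' _).differentiableAt)
        (fun x hx => by
          have h1 := hnorm x hx _ (hnat k)
          rwa [mul_right_comm] at h1) (hw 0) (hwb 0)
      rw [← h.tsum_eq, ← tsum_mul_right]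
      exact tsum_congr fun m => by ring
    rw [hfub, integral_congr_ae hinner, ← hswap]
    simp only [houter]
    have hs2 := ((Fin.consEquiv fun _ => ℕ).summable_iff.2 hsum)
    have hs3 := ((Equiv.prodComm (Fin n → ℕ) ℕ).summable_iff.2 hs2)
    rw [← (Fin.consEquiv fun _ => ℕ).tsum_eq, ← (Equiv.prodComm (Fin n → ℕ) ℕ).tsum_eq]
    have hcast : ∀ (m : ℕ) (k : Fin n → ℕ), (fun j => (((Fin.cons m k : Fin (n + 1) → ℕ) j : ℕ) : ℂ))
        = Fin.cons (m : ℂ) fun j => (k j : ℂ) := by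
      intro m k
      funext j
      refine Fin.cases (by simp) (fun i => by simp) j
    refine Eq.trans ?_ (Summable.tsum_prod hs3).symm
    refine tsum_congr fun k => tsum_congr fun m => ?_
    simp [Fin.prod_univ_succ, hcast]

end

/-! ### The domain of convergence of a multiple power series -/

section

variable {n : ℕ} {f : (Fin n → ℕ) → ℂ}

theorem norm_term (f : (Fin n → ℕ) → ℂ) (z : Fin n → ℂ) (k : Fin n → ℕ) :
    ‖term f z k‖ = ‖f k‖ * ∏ j, ‖z j‖ ^ k j := by
  simp [term]

theorem norm_term_le {z z' : Fin n → ℂ} (h : ∀ j, ‖z' j‖ ≤ ‖z j‖) (k : Fin n → ℕ) :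
    ‖term f z' k‖ ≤ ‖term f z k‖ := by
  rw [norm_term, norm_term]
  gcongr with j
  exact h j

/-- The domain of convergence is the union of the open polydiscs whose distinguished boundary
contains a point of absolute convergence. -/
theorem mem_convergenceDomain_iff {z : Fin n → ℂ} :
    z ∈ convergenceDomain f ↔
      ∃ r : Fin n → ℝ, (∀ j, ‖z j‖ < r j) ∧ Summable fun k => ‖term f (fun j => (r j : ℂ)) k‖ := by
  constructor
  · intro hz
    obtain ⟨ε, hε, hball⟩ := Metric.mem_nhds_iff.1 (mem_interior_iff_mem_nhds.1 hz)
    -- move every coordinate radially outwards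
    set u : Fin n → ℂ := fun j => if z j = 0 then 1 else z j / ‖z j‖ with hu
    have hnorm : ∀ j, ‖z j + (ε / 2 : ℝ) * u j‖ = ‖z j‖ + ε / 2 := by
      intro j
      by_cases h : z j = 0
      · simp [hu, h, abs_of_pos hε]
      · have h' : (‖z j‖ : ℂ) ≠ 0 := by simpa using h
        have e : z j + (ε / 2 : ℝ) * u j = ((‖z j‖ + ε / 2 : ℝ) : ℂ) * (z j / ‖z j‖) := by
          simp only [hu, h, if_false]
          push_cast
          field_simp
        rw [e, norm_mul, norm_div, norm_real, norm_real, Real.norm_of_nonneg (by positivity),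
          norm_norm, div_self (by simpa using h), mul_one]
    refine ⟨fun j => ‖z j‖ + ε / 2, fun j => by linarith, ?_⟩
    have hmem : (fun j => z j + (ε / 2 : ℝ) * u j) ∈ Metric.ball z ε := by
      rw [Metric.mem_ball, dist_eq_norm]
      refine lt_of_le_of_lt ((pi_norm_le_iff_of_nonneg (by positivity : 0 ≤ ε / 2)).2 fun j => ?_)
        (half_lt_self hε)
      have hu1 : ‖u j‖ = 1 := by
        simp only [hu]
        split_ifs with h
        · simp
        · rw [norm_div, norm_real, norm_norm, div_self (by simpa using h)]
      simp [hu1, abs_of_pos hε]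
    refine (hball hmem).congr fun k => ?_
    rw [norm_term, norm_term]
    congr 1
    refine Finset.prod_congr rfl fun j _ => ?_
    rw [hnorm, norm_real, Real.norm_of_nonneg (by positivity)]
  · rintro ⟨r, hr, hs⟩
    have hopen : IsOpen {z : Fin n → ℂ | ∀ j, ‖z j‖ < r j} := by
      simp only [Set.ofPred_forall]
      exact isOpen_iInter_of_finite fun j => isOpen_lt (by fun_prop) continuous_const
    refine mem_interior.2 ⟨_, fun y hy => ?_, hopen, hr⟩
    refine Summable.of_nonneg_of_le (fun k => norm_nonneg _) (fun k => norm_term_le (fun j => ?_) k)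
      hs
    rw [norm_real]
    exact (hy j).le.trans (le_abs_self _)

theorem isOpen_convergenceDomain : IsOpen (convergenceDomain f) := isOpen_interior

theorem summable_term {z : Fin n → ℂ} (hz : z ∈ convergenceDomain f) : Summable (term f z) :=
  Summable.of_norm (interior_subset hz : z ∈ {z | Summable fun k => ‖term f z k‖})

theorem summable_norm_term_convex {x y : Fin n → ℝ} {s t : ℝ} (hs : 0 ≤ s) (ht : 0 ≤ t)
    (hst : s + t = 1)
    (hx : Summable fun k => ‖term f (fun j => ((Real.exp (x j) : ℝ) : ℂ)) k‖)
    (hy : Summable fun k => ‖term f (fun j => ((Real.exp (y j) : ℝ) : ℂ)) k‖) :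
    Summable fun k => ‖term f (fun j => ((Real.exp (s * x j + t * y j) : ℝ) : ℂ)) k‖ := by
  have hexp : ∀ (x : Fin n → ℝ) (k : Fin n → ℕ),
      ‖term f (fun j => ((Real.exp (x j) : ℝ) : ℂ)) k‖ = ‖f k‖ * Real.exp (∑ j, k j * x j) := by
    intro x k
    rw [norm_term, Real.exp_sum]
    congr 1
    refine Finset.prod_congr rfl fun j _ => ?_
    rw [norm_real, Real.norm_of_nonneg (Real.exp_pos _).le, Real.exp_nat_mul]
  refine Summable.of_nonneg_of_le (fun k => norm_nonneg _) (fun k => ?_)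
    ((hx.mul_left s).add (hy.mul_left t))
  rw [hexp, hexp, hexp]
  have h := convexOn_exp.2 (Set.mem_univ (∑ j, k j * x j)) (Set.mem_univ (∑ j, k j * y j)) hs ht hst
  simp only [smul_eq_mul] at h
  have e : ∑ j, (k j : ℝ) * (s * x j + t * y j) =
      s * (∑ j, k j * x j) + t * ∑ j, k j * y j := by
    rw [Finset.mul_sum, Finset.mul_sum, ← Finset.sum_add_distrib]
    exact Finset.sum_congr rfl fun j _ => by ring
  rw [e]
  calc _ ≤ ‖f k‖ * (s * Real.exp (∑ j, k j * x j) + t * Real.exp (∑ j, k j * y j)) := by gcongr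
    _ = _ := by ring

/-- In logarithmic coordinates the domain of convergence is convex. -/
theorem convex_exp_preimage_convergenceDomain :
    Convex ℝ {w : Fin n → ℂ | (fun j => exp (w j)) ∈ convergenceDomain f} := by
  intro w hw v hv s t hs ht hst
  rw [Set.mem_ofPred_eq, mem_convergenceDomain_iff] at hw hv ⊢
  obtain ⟨r, hr, hrs⟩ := hw
  obtain ⟨q, hq, hqs⟩ := hv
  have hr0 : ∀ j, 0 < r j := fun j => (norm_nonneg _).trans_lt (hr j)
  have hq0 : ∀ j, 0 < q j := fun j => (norm_nonneg _).trans_lt (hq j)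
  refine ⟨fun j => Real.exp (s * Real.log (r j) + t * Real.log (q j)), fun j => ?_, ?_⟩
  · have h1 := hr j
    have h2 := hq j
    rw [norm_exp, ← Real.lt_log_iff_exp_lt (hr0 j)] at h1
    rw [norm_exp, ← Real.lt_log_iff_exp_lt (hq0 j)] at h2
    rw [norm_exp, Real.exp_lt_exp]
    simp only [Pi.add_apply, Pi.smul_apply, add_re, real_smul, mul_re, ofReal_re, ofReal_im,
      zero_mul, sub_zero]
    rcases hs.eq_or_lt with rfl | hs0
    · rw [zero_add] at hst
      subst hst
      linarith
    · have := mul_lt_mul_of_pos_left h1 hs0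
      have := mul_le_mul_of_nonneg_left h2.le ht
      linarith
  · refine summable_norm_term_convex hs ht hst ?_ ?_
    · simpa only [Real.exp_log (hr0 _)] using hrs
    · simpa only [Real.exp_log (hq0 _)] using hqs

theorem differentiableAt_tsum_term {z : Fin n → ℂ} (hz : z ∈ convergenceDomain f) :
    DifferentiableAt ℂ (fun z => ∑' k, term f z k) z := by
  obtain ⟨r, hr, hs⟩ := mem_convergenceDomain_iff.1 hz
  have hopen : IsOpen {z : Fin n → ℂ | ∀ j, ‖z j‖ < r j} := by
    simp only [Set.ofPred_forall]
    exact isOpen_iInter_of_finite fun j => isOpen_lt (by fun_prop) continuous_const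
  obtain ⟨ε, hε, hball⟩ := Metric.isOpen_iff.1 hopen z hr
  have hle : ∀ y ∈ Metric.ball z ε, ∀ k, ‖term f y k‖ ≤ ‖term f (fun j => (r j : ℂ)) k‖ := by
    intro y hy k
    refine norm_term_le (fun j => ?_) k
    rw [norm_real]
    exact (hball hy j).le.trans (le_abs_self _)
  have h := differentiableAt_integral_of_dominated (μ := (Measure.count : Measure (Fin n → ℕ)))
    (F := fun z k => term f z k) hε (bound := fun k => ‖term f (fun j => (r j : ℂ)) k‖)
    (integrable_count_iff.2 (by simpa using hs)) (fun _ _ => .of_discrete) .of_discrete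
    (Eventually.of_forall fun k y _ => by unfold term; fun_prop)
    (Eventually.of_forall fun k y hy => hle y hy k)
  refine h.congr_of_eventuallyEq ?_
  filter_upwards [Metric.ball_mem_nhds z hε] with y hy
  rw [integral_countable]
  · simp
  · refine integrable_count_iff.2 (Summable.of_nonneg_of_le (fun k => norm_nonneg _) (hle y hy) hs)

theorem mem_convergenceDomain_of_norm_lt {b C : ℝ}
    (hf : ∀ k : Fin n → ℕ, ‖f k‖ ≤ C * ∏ j, Real.exp (b * k j)) {z : Fin n → ℂ}
    (hz : ∀ j, ‖z j‖ < Real.exp (-b - 1)) : z ∈ convergenceDomain f := by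
  refine mem_convergenceDomain_iff.2 ⟨fun _ => Real.exp (-b - 1), hz, ?_⟩
  refine Summable.of_nonneg_of_le (fun k => norm_nonneg _) (fun k => ?_)
    ((summable_prod_pi (g := fun (_ : Fin n) k => Real.exp (-1) ^ k) (fun _ _ => by positivity)
      fun _ => summable_geometric_of_lt_one (Real.exp_pos _).le (by simp)).mul_left C)
  rw [norm_term]
  refine (mul_le_mul_of_nonneg_right (hf k) (by positivity)).trans (le_of_eq ?_)
  rw [mul_assoc, ← Finset.prod_mul_distrib]
  congr 1
  refine Finset.prod_congr rfl fun j _ => ?_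
  rw [norm_real, Real.norm_of_nonneg (Real.exp_pos _).le, ← Real.exp_nat_mul, ← Real.exp_nat_mul,
    ← Real.exp_add]
  congr 1
  ring

end

/-! ### Cones of the arrangement -/

section

variable {n q : ℕ} {a : Fin q → Fin n → ℝ} {ε : Fin q → ℝ}

theorem form_add (i : Fin q ⊕ Fin n) (η η' : Fin n → ℝ) :
    form a i (η + η') = form a i η + form a i η' := by
  cases i with
  | inl p => simp [form, mul_add, Finset.sum_add_distrib]
  | inr k => simp [form]

theorem form_smul (i : Fin q ⊕ Fin n) (t : ℝ) (η : Fin n → ℝ) :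
    form a i (t • η) = t * form a i η := by
  cases i with
  | inl p => simp [form, Finset.mul_sum, mul_left_comm]
  | inr k => simp [form]

theorem gLin_eq (η : Fin n → ℝ) : gLin ε a η =
    ∑ p, ε p * |form a (Sum.inl p) η| + Real.pi * ∑ k, (η k - |form a (Sum.inr k) η|) := rfl

/-- The amount by which `α` satisfies the inequality defining the polytope at `η`, with a margin
proportional to the `ℓ¹`-norm of `η`. It is linear on the cones of the fan. -/
noncomputable def slack (ε : Fin q → ℝ) (a : Fin q → Fin n → ℝ) (r : ℝ) (α η : Fin n → ℝ) : ℝ :=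
  ∑ j, η j * α j - gLin ε a η - r * ∑ j, |η j|

theorem slack_add {r : ℝ} {α η η' : Fin n → ℝ}
    (h : ∀ i, |form a i (η + η')| = |form a i η| + |form a i η'|) :
    slack ε a r α (η + η') = slack ε a r α η + slack ε a r α η' := by
  have h2 : ∀ k, |η k + η' k| = |η k| + |η' k| := fun k => h (Sum.inr k)
  have h3 : ∀ p, |form a (Sum.inl p) (η + η')| =
    |form a (Sum.inl p) η| + |form a (Sum.inl p) η'| := fun p => h (Sum.inl p)
  have h4 : ∀ k, |form a (Sum.inr k) (η + η')| =
    |form a (Sum.inr k) η| + |form a (Sum.inr k) η'| := fun p => h (Sum.inr p)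
  simp only [slack, gLin_eq, h3, h4, Pi.add_apply, h2, add_mul, mul_add, Finset.sum_add_distrib,
    Finset.sum_sub_distrib]
  ring

theorem slack_smul {r t : ℝ} (ht : 0 ≤ t) {α η : Fin n → ℝ} :
    slack ε a r α (t • η) = t * slack ε a r α η := by
  have h1 : ∑ j, (t • η) j * α j = t * ∑ j, η j * α j := by
    rw [Finset.mul_sum]; exact Finset.sum_congr rfl fun j _ => by simp [mul_assoc]
  have h2 : ∑ j, |(t • η) j| = t * ∑ j, |η j| := by
    rw [Finset.mul_sum]; exact Finset.sum_congr rfl fun j _ => by simp [abs_mul, abs_of_nonneg ht]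
  have h3 : ∑ p, ε p * |form a (Sum.inl p) (t • η)| = t * ∑ p, ε p * |form a (Sum.inl p) η| := by
    rw [Finset.mul_sum]
    exact Finset.sum_congr rfl fun p _ => by rw [form_smul, abs_mul, abs_of_nonneg ht]; ring
  have h4 : ∑ k, ((t • η) k - |form a (Sum.inr k) (t • η)|) =
      t * ∑ k, (η k - |form a (Sum.inr k) η|) := by
    rw [Finset.mul_sum]
    exact Finset.sum_congr rfl fun k _ => by
      rw [form_smul, abs_mul, abs_of_nonneg ht, Pi.smul_apply, smul_eq_mul]; ring
  simp only [slack, gLin_eq, h1, h2, h3, h4]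
  ring

/-- The closed cone of the arrangement that contains `η` in its relative interior. -/
def minimalCone (a : Fin q → Fin n → ℝ) (η : Fin n → ℝ) : Set (Fin n → ℝ) :=
  signCone a fun i => SignType.sign (form a i η)

/-- The number of forms that do not vanish at `η`. -/
noncomputable def supportCard (a : Fin q → Fin n → ℝ) (η : Fin n → ℝ) : ℕ :=
  (Finset.univ.filter fun i => form a i η ≠ 0).card

/-- Moving from `η` in the direction opposite to a nonzero vector of its cone, one reaches a proper
face of the cone. -/
theorem exists_sub_smul_mem_minimalCone {η η' : Fin n → ℝ} (hη' : η' ∈ minimalCone a η)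
    (hne : η' ≠ 0) :
    ∃ t : ℝ, 0 < t ∧ η - t • η' ∈ minimalCone a η ∧
      supportCard a (η - t • η') < supportCard a η ∧
      ∀ i, |form a i (η - t • η' + t • η')| =
        |form a i (η - t • η')| + |form a i (t • η')| := by
  classical
  set S : Finset (Fin q ⊕ Fin n) := Finset.univ.filter fun i => form a i η' ≠ 0 with hS
  have hSne : S.Nonempty := by
    obtain ⟨k, hk⟩ := Function.ne_iff.1 hne
    exact ⟨Sum.inr k, Finset.mem_filter.2 ⟨Finset.mem_univ _, hk⟩⟩
  have hratio : ∀ i ∈ S, 0 < form a i η / form a i η' := by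
    intro i hi
    have hi' : form a i η' ≠ 0 := by simpa [hS] using hi
    have h := (hη' i).resolve_left (by simpa using hi')
    rcases lt_or_gt_of_ne hi' with h1 | h1
    · rw [sign_neg h1, eq_comm, sign_eq_neg_one_iff] at h
      exact div_pos_of_neg_of_neg h h1
    · rw [sign_pos h1, eq_comm, sign_eq_one_iff] at h
      exact div_pos h h1
  obtain ⟨i₀, hi₀, hmin⟩ := S.exists_min_image (fun i => form a i η / form a i η') hSne
  set t := form a i₀ η / form a i₀ η' with ht
  have ht0 : 0 < t := hratio i₀ hi₀
  have hform : ∀ i, form a i (η - t • η') = form a i η - t * form a i η' := by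
    intro i
    rw [sub_eq_add_neg, ← neg_smul, form_add, form_smul]
    ring
  -- the value of each form at the new point is a nonnegative multiple of its value at `η`
  have hmul : ∀ i, ∃ l : ℝ, 0 ≤ l ∧ l ≤ 1 ∧ form a i (η - t • η') = l * form a i η := by
    intro i
    by_cases hi : form a i η' = 0
    · exact ⟨1, zero_le_one, le_rfl, by rw [hform, hi]; ring⟩
    · have hiS : i ∈ S := by simpa [hS] using hi
      have h1 := hmin i hiS
      have h2 := hratio i hiS
      have hη : form a i η ≠ 0 := by
        intro h
        rw [h, zero_div] at h2
        exact lt_irrefl _ h2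
      refine ⟨1 - t / (form a i η / form a i η'), ?_, ?_, ?_⟩
      · rw [sub_nonneg, div_le_one h2]; exact h1
      · have : 0 < t / (form a i η / form a i η') := div_pos ht0 h2
        linarith
      · rw [hform]; field_simp
  refine ⟨t, ht0, fun i => ?_, ?_, fun i => ?_⟩
  · obtain ⟨l, hl0, -, hl⟩ := hmul i
    rw [hl]
    rcases hl0.eq_or_lt with rfl | h
    · left; simp
    · right; rw [sign_mul, sign_pos h, one_mul]
  · refine Finset.card_lt_card (Finset.ssubset_iff_subset_ne.2 ⟨fun i => ?_, fun h => ?_⟩)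
    · simp only [Finset.mem_filter, Finset.mem_univ, true_and]
      obtain ⟨l, -, -, hl⟩ := hmul i
      intro h1 h2
      exact h1 (by rw [hl, h2, mul_zero])
    · have hi₀' : form a i₀ η' ≠ 0 := by simpa [hS] using hi₀
      have h1 : form a i₀ η ≠ 0 := by
        intro h'
        rw [ht, h', zero_div] at ht0
        exact lt_irrefl _ ht0
      have h2 : i₀ ∈ Finset.univ.filter fun i => form a i (η - t • η') ≠ 0 := by
        rw [h]; simpa using h1
      rw [Finset.mem_filter, hform, ht, div_mul_cancel₀ _ hi₀', sub_self] at h2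
      exact h2.2 rfl
  · obtain ⟨l, hl0, hl1, hl⟩ := hmul i
    have e : form a i (t • η') = (1 - l) * form a i η := by
      rw [form_smul]
      rw [hform] at hl
      linarith
    rw [form_add, hl, e, abs_mul, abs_mul, abs_of_nonneg hl0, abs_of_nonneg (sub_nonneg.2 hl1),
      ← add_mul, ← add_mul, add_sub_cancel, one_mul, one_mul]

/-- A function that is linear on the cones of the fan and nonnegative on the generators of the rays
is nonnegative: a point that is not on a ray is a combination of two points on proper faces of its
cone. -/
theorem slack_nonneg {r : ℝ} {α : Fin n → ℝ} (h : ∀ μ, IsRayGenerator a μ → 0 ≤ slack ε a r α μ)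
    (η : Fin n → ℝ) : 0 ≤ slack ε a r α η := by
  induction hN : supportCard a η using Nat.strong_induction_on generalizing η with
  | _ N ih =>
    subst hN
    rcases eq_or_ne η 0 with rfl | h0
    · have := slack_smul (ε := ε) (a := a) (r := r) (α := α) (η := 0) le_rfl
      rw [smul_zero, zero_mul] at this
      exact this.ge
    by_cases hray : IsRayGenerator a η
    · exact h η hray
    have hsub : {x : Fin n → ℝ | ∃ t : ℝ, 0 ≤ t ∧ x = t • η} ⊆ minimalCone a η := by
      rintro _ ⟨t, ht, rfl⟩ i
      rw [form_smul]
      rcases ht.eq_or_lt with rfl | h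
      · left; simp
      · right; rw [sign_mul, sign_pos h, one_mul]
    obtain ⟨η', hη', hnot⟩ : ∃ η' ∈ minimalCone a η,
        η' ∉ {x : Fin n → ℝ | ∃ t : ℝ, 0 ≤ t ∧ x = t • η} := by
      by_contra! hcon
      exact hray ⟨h0, ⟨_, Set.Subset.antisymm hcon hsub⟩⟩
    have hη'0 : η' ≠ 0 := by
      rintro rfl
      exact hnot ⟨0, le_rfl, by simp⟩
    obtain ⟨t, ht, hmem, hcard, -⟩ := exists_sub_smul_mem_minimalCone hη' hη'0
    have hρ : η - t • η' ≠ 0 := by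
      intro h1
      refine hnot ⟨t⁻¹, by positivity, ?_⟩
      rw [sub_eq_zero.1 h1, smul_smul, inv_mul_cancel₀ ht.ne', one_smul]
    obtain ⟨t', ht', -, hcard', habs⟩ := exists_sub_smul_mem_minimalCone hmem hρ
    have h1 := slack_add (ε := ε) (r := r) (α := α) habs
    rw [sub_add_cancel, slack_smul ht'.le] at h1
    rw [h1]
    exact add_nonneg (ih _ hcard' _ rfl) (mul_nonneg ht'.le (ih _ hcard _ rfl))

/-- The vectors `α` that satisfy the inequality `g(η) ≤ ⟨η, α⟩` for all `η` with a margin greater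
than `κ |η|₁`. -/
def marginSet (ε : Fin q → ℝ) (a : Fin q → Fin n → ℝ) (κ : ℝ) : Set (Fin n → ℝ) :=
  {α | ∃ r, κ < r ∧ ∀ η, 0 ≤ slack ε a r α η}

/-- In the interior, `α` can be moved against the signs of the coordinates of a generator `μ`, which
lowers `⟨μ, α⟩` by a multiple of `|μ|₁`. -/
theorem interior_polytope_subset : interior (polytope ε a) ⊆ marginSet ε a 0 := by
  intro α hα
  obtain ⟨δ, hδ, hball⟩ := Metric.mem_nhds_iff.1 (mem_interior_iff_mem_nhds.1 hα)
  refine ⟨δ / 2, by positivity, slack_nonneg fun μ hμ => ?_⟩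
  have hmem : (fun j => α j - δ / 2 * (SignType.sign (μ j) : ℝ)) ∈ Metric.ball α δ := by
    rw [Metric.mem_ball, dist_eq_norm]
    refine lt_of_le_of_lt ((pi_norm_le_iff_of_nonneg (by positivity : 0 ≤ δ / 2)).2 fun j => ?_)
      (half_lt_self hδ)
    rw [Pi.sub_apply, sub_sub_cancel_left, norm_neg, Real.norm_eq_abs, abs_mul,
      abs_of_pos (by positivity : 0 < δ / 2)]
    refine mul_le_of_le_one_right (by positivity) ?_
    rcases lt_trichotomy (μ j) 0 with h | h | h
    · simp [sign_neg h]
    · simp [h]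
    · simp [sign_pos h]
  have h := hball hmem μ hμ
  have e : ∑ j, μ j * (α j - δ / 2 * (SignType.sign (μ j) : ℝ)) =
      ∑ j, μ j * α j - δ / 2 * ∑ j, |μ j| := by
    rw [Finset.mul_sum, ← Finset.sum_sub_distrib]
    refine Finset.sum_congr rfl fun j _ => ?_
    rw [← self_mul_sign (μ j)]
    ring
  rw [e] at h
  unfold slack
  linarith

theorem slack_convex {r s t : ℝ} {α α' η : Fin n → ℝ} (hst : s + t = 1) :
    slack ε a r (s • α + t • α') η = s * slack ε a r α η + t * slack ε a r α' η := by
  have e : ∑ j, η j * (s • α + t • α') j = s * (∑ j, η j * α j) + t * ∑ j, η j * α' j := by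
    rw [Finset.mul_sum, Finset.mul_sum, ← Finset.sum_add_distrib]
    refine Finset.sum_congr rfl fun j _ => ?_
    simp only [Pi.add_apply, Pi.smul_apply, smul_eq_mul]
    ring
  have h : t = 1 - s := by linarith
  subst h
  simp only [slack, e]
  ring

theorem slack_anti {r r' : ℝ} (h : r ≤ r') (α η : Fin n → ℝ) :
    slack ε a r' α η ≤ slack ε a r α η := by
  unfold slack
  have : r * ∑ j, |η j| ≤ r' * ∑ j, |η j| := by gcongr
  linarith

theorem convex_marginSet (κ : ℝ) : Convex ℝ (marginSet ε a κ) := by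
  rintro α ⟨r, hr, h⟩ α' ⟨r', hr', h'⟩ s t hs ht hst
  refine ⟨min r r', lt_min hr hr', fun η => ?_⟩
  rw [slack_convex hst]
  exact add_nonneg (mul_nonneg hs ((h η).trans (slack_anti (min_le_left _ _) _ _)))
    (mul_nonneg ht ((h' η).trans (slack_anti (min_le_right _ _) _ _)))

theorem slack_sub_le {r d : ℝ} {α α' : Fin n → ℝ} (h : ∀ j, |α' j - α j| ≤ d) (η : Fin n → ℝ) :
    slack ε a r α η ≤ slack ε a (r - d) α' η := by
  have h1 : ∑ j, η j * α j - ∑ j, η j * α' j ≤ d * ∑ j, |η j| := by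
    rw [← Finset.sum_sub_distrib, Finset.mul_sum]
    refine Finset.sum_le_sum fun j _ => ?_
    rw [← mul_sub, mul_comm d]
    refine (le_abs_self _).trans ?_
    rw [abs_mul, abs_sub_comm]
    gcongr
    exact h j
  unfold slack
  linarith

theorem isOpen_marginSet (κ : ℝ) : IsOpen (marginSet ε a κ) := by
  rw [Metric.isOpen_iff]
  rintro α ⟨r, hr, h⟩
  refine ⟨(r - κ) / 2, by linarith, fun α' hα' => ⟨r - (r - κ) / 2, by linarith, fun η => ?_⟩⟩
  refine (h η).trans (slack_sub_le (fun j => ?_) η)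
  have := (dist_le_pi_dist α' α j).trans (Metric.mem_ball.1 hα').le
  rwa [Real.dist_eq] at this

/-- The set of margins is symmetric about `(π, …, π)`, because `⟨η, α⟩ - g(η)` is unchanged when
`η` and `α` are replaced by `-η` and `2π - α`. By convexity it contains the centre. -/
theorem pi_mem_marginSet {κ : ℝ} {α : Fin n → ℝ} (hα : α ∈ marginSet ε a κ) :
    (fun _ => Real.pi) ∈ marginSet ε a κ := by
  have hrefl : (fun j => 2 * Real.pi - α j) ∈ marginSet ε a κ := by
    obtain ⟨r, hr, h⟩ := hα
    refine ⟨r, hr, fun η => (h (-η)).trans (le_of_eq ?_)⟩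
    have hneg : ∀ i, |form a i (-η)| = |form a i η| := by
      intro i
      rw [← neg_one_smul ℝ η, form_smul, neg_one_mul, abs_neg]
    simp only [slack, gLin_eq, hneg, Pi.neg_apply, abs_neg, Finset.sum_sub_distrib, mul_sub,
      neg_mul, Finset.sum_neg_distrib, Finset.mul_sum]
    have : ∑ x, η x * (2 * Real.pi) = 2 * ∑ x, Real.pi * η x := by
      rw [Finset.mul_sum]; exact Finset.sum_congr rfl fun _ _ => by ring
    have e : ∑ x, Real.pi * η x = Real.pi * ∑ x, η x := (Finset.mul_sum _ _ _).symm
    rw [this, e]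
    ring
  have h := convex_marginSet κ hα hrefl (by norm_num : (0 : ℝ) ≤ 1 / 2) (by norm_num : (0 : ℝ) ≤ 1 / 2)
    (by norm_num)
  convert h using 1
  funext j
  simp only [Pi.add_apply, Pi.smul_apply, smul_eq_mul]
  ring

end

/-! ### Growth near the imaginary subspace -/

section

variable {n q : ℕ} {a : Fin q → Fin n → ℝ} {ε : Fin q → ℝ}

/-- The homogeneous part `∑ₚ εₚ |aₚ·η|` of the bound on the imaginary subspace. -/
noncomputable def homPart (ε : Fin q → ℝ) (a : Fin q → Fin n → ℝ) (η : Fin n → ℝ) : ℝ :=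
  ∑ p, ε p * |∑ j, a p j * η j|

/-- Passing to the homogeneous part and moving by `y` in a direction with coordinates in `[0, 1]`
changes the bound by at most a multiple of `|y|` plus a constant. -/
theorem gTilde_add_smul_le (hε : ∀ p, ε p = 1 ∨ ε p = -1) (a₀ : Fin q → ℝ) (η : Fin n → ℝ)
    {v : Fin n → ℝ} (hv : ∀ j, v j ∈ Set.Icc (0 : ℝ) 1) (y : ℝ) :
    gTilde ε a a₀ (fun j => η j + y * v j) ≤
      homPart ε a η + (∑ p, ∑ j, |a p j|) * |y| + ∑ p, |a₀ p| := by
  unfold gTilde homPart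
  rw [Finset.sum_mul, ← Finset.sum_add_distrib, ← Finset.sum_add_distrib]
  refine Finset.sum_le_sum fun p _ => ?_
  have h1 : |∑ j, a p j * (y * v j)| ≤ (∑ j, |a p j|) * |y| := by
    rw [Finset.sum_mul]
    refine (Finset.abs_sum_le_sum_abs _ _).trans (Finset.sum_le_sum fun j _ => ?_)
    rw [abs_mul, abs_mul, abs_of_nonneg (hv j).1]
    have := mul_le_of_le_one_right (abs_nonneg y) (hv j).2
    gcongr
  have e : ∑ j, a p j * (η j + y * v j) = ∑ j, a p j * η j + ∑ j, a p j * (y * v j) := by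
    rw [← Finset.sum_add_distrib]; exact Finset.sum_congr rfl fun j _ => by ring
  rw [e]
  set A := ∑ j, a p j * η j
  set B := ∑ j, a p j * (y * v j)
  have h2 : |A + B + a₀ p| ≤ |A| + |B| + |a₀ p| := abs_add_three _ _ _
  have h3 : |A| ≤ |A + B + a₀ p| + |B| + |a₀ p| := by
    have := abs_add_three (A + B + a₀ p) (-B) (-a₀ p)
    rw [abs_neg, abs_neg, show A + B + a₀ p + -B + -a₀ p = A by ring] at this
    exact this
  rcases hε p with h | h <;> rw [h] <;> linarith

theorem abs_homPart_le (hε : ∀ p, ε p = 1 ∨ ε p = -1) (η : Fin n → ℝ) :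
    |homPart ε a η| ≤ (∑ p, ∑ j, |a p j|) * ∑ j, |η j| := by
  unfold homPart
  rw [Finset.sum_mul]
  refine (Finset.abs_sum_le_sum_abs _ _).trans (Finset.sum_le_sum fun p _ => ?_)
  have : |ε p| = 1 := by rcases hε p with h | h <;> simp [h]
  rw [abs_mul, this, one_mul, abs_abs, Finset.sum_mul]
  refine (Finset.abs_sum_le_sum_abs _ _).trans (Finset.sum_le_sum fun j _ => ?_)
  rw [abs_mul]
  gcongr
  exact Finset.single_le_sum (f := fun j => |η j|) (fun _ _ => abs_nonneg _) (Finset.mem_univ j)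

/-- The sharp bound on the imaginary subspace persists at distance `c` from it, up to a loss of
`O(c)` in the exponential type. This is the three lines theorem on a complex line in a real
direction, with the factor `e^{λ²}` compensating for the growth along the strip. -/
theorem exists_norm_le_near_imaginary (hε : ∀ p, ε p = 1 ∨ ε p = -1) {a₀ : Fin q → ℝ}
    {φ : (Fin n → ℂ) → ℂ} (hφ : ∀ ζ ∈ closedRightDomain n, DifferentiableAt ℂ φ ζ)
    (h₁ : ∀ η : Fin n → ℝ, ‖φ (fun j => (η j : ℂ) * I)‖ ≤ Real.exp (gTilde ε a a₀ η))
    {b C δ : ℝ} (hδ : 0 < δ)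
    (h₂ : ∀ ζ ∈ closedRightDomain n,
      ‖φ ζ‖ ≤ Real.exp ((∑ j, ((Real.pi - δ) * |(ζ j).im| + b * (ζ j).re)) + C)) :
    ∃ K M : ℝ, 0 ≤ K ∧ 0 ≤ M ∧ ∀ c ∈ Set.Ioc (0 : ℝ) 1, ∀ ζ : Fin n → ℂ,
      (∀ j, (ζ j).re ∈ Set.Icc 0 c) →
      ‖φ ζ‖ ≤ K * Real.exp (homPart ε a (fun j => (ζ j).im) + c * M * ∑ j, |(ζ j).im|) := by
  set L := ∑ p, ∑ j, |a p j| with hL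
  have hL0 : 0 ≤ L := Finset.sum_nonneg fun p _ => Finset.sum_nonneg fun j _ => abs_nonneg _
  have hpi := Real.pi_pos
  set C₁ := L ^ 2 / 4 + ∑ p, |a₀ p| with hC₁
  set C₂ := (n * Real.pi) ^ 2 / 4 + n * |b| + C + 1 with hC₂
  refine ⟨Real.exp (|C₁| + |C₂|), Real.pi + L, (Real.exp_pos _).le, by positivity, ?_⟩
  intro c hc ζ hζ
  set η : Fin n → ℝ := fun j => (ζ j).im with hη
  set v : Fin n → ℝ := fun j => (ζ j).re / c with hv
  have hv01 : ∀ j, v j ∈ Set.Icc (0 : ℝ) 1 := fun j =>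
    ⟨div_nonneg (hζ j).1 hc.1.le, (div_le_one hc.1).2 (hζ j).2⟩
  set p : ℂ → Fin n → ℂ := fun l j => l * v j + η j * I with hp
  have hpd : Differentiable ℂ p := differentiable_pi.2 fun j => by simp only [hp]; fun_prop
  have hpre : ∀ l j, (p l j).re = l.re * v j := fun l j => by simp [hp]
  have hpim : ∀ l j, (p l j).im = η j + l.im * v j := fun l j => by simp [hp, add_comm]
  have hpmem : ∀ l : ℂ, 0 ≤ l.re → p l ∈ closedRightDomain n := fun l hl j => by
    rw [hpre]; exact mul_nonneg hl (hv01 j).1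
  set u : ℂ → ℂ := fun l => φ (p l) * exp (l ^ 2) with hu
  have hud : ∀ l : ℂ, 0 ≤ l.re → DifferentiableAt ℂ u l := fun l hl =>
    ((hφ _ (hpmem l hl)).comp l hpd.differentiableAt).mul (by fun_prop)
  have hsq : ∀ l : ℂ, ‖exp (l ^ 2)‖ = Real.exp (l.re ^ 2 - l.im ^ 2) := fun l => by
    rw [norm_exp, sq, mul_re, sq, sq]
  set S := ∑ j, |η j| with hS
  have hleft : ∀ l ∈ re ⁻¹' {(0 : ℝ)}, ‖u l‖ ≤ Real.exp (homPart ε a η + C₁) := by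
    intro l hl
    have hl0 : l.re = 0 := hl
    have e : p l = fun j => ((η j + l.im * v j : ℝ) : ℂ) * I := by
      funext j
      apply Complex.ext
      · rw [hpre, hl0]; simp
      · rw [hpim]; simp
    rw [hu, norm_mul, hsq, e]
    refine (mul_le_mul_of_nonneg_right (h₁ _) (Real.exp_pos _).le).trans ?_
    rw [← Real.exp_add, Real.exp_le_exp, hl0]
    have := gTilde_add_smul_le (a := a) hε a₀ η hv01 l.im
    have h3 : L * |l.im| - |l.im| ^ 2 ≤ L ^ 2 / 4 := by nlinarith [sq_nonneg (|l.im| - L / 2)]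
    rw [sq_abs] at h3
    linarith
  have hstrip : ∀ l : ℂ, l.re ∈ Set.Icc (0 : ℝ) 1 → ‖u l‖ ≤ Real.exp (Real.pi * S + C₂) := by
    intro l hl
    rw [hu, norm_mul, hsq]
    refine (mul_le_mul_of_nonneg_right (h₂ _ (hpmem l hl.1)) (Real.exp_pos _).le).trans ?_
    rw [← Real.exp_add, Real.exp_le_exp]
    have h3 : ∑ j, ((Real.pi - δ) * |(p l j).im| + b * (p l j).re) ≤
        ∑ j, (Real.pi * |η j| + (Real.pi * |l.im| + |b|)) := by
      refine Finset.sum_le_sum fun j _ => ?_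
      rw [hpre, hpim]
      have h4 : |η j + l.im * v j| ≤ |η j| + |l.im| := by
        refine (abs_add_le _ _).trans ?_
        rw [abs_mul, abs_of_nonneg (hv01 j).1]
        have := mul_le_of_le_one_right (abs_nonneg l.im) (hv01 j).2
        linarith
      have h5 : b * (l.re * v j) ≤ |b| := by
        refine (le_abs_self _).trans ?_
        rw [abs_mul, abs_of_nonneg (mul_nonneg hl.1 (hv01 j).1)]
        exact mul_le_of_le_one_right (abs_nonneg b) (mul_le_one₀ hl.2 (hv01 j).1 (hv01 j).2)
      have h6 : 0 ≤ |η j + l.im * v j| := abs_nonneg _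
      nlinarith
    have h3' : ∑ j, (Real.pi * |η j| + (Real.pi * |l.im| + |b|)) =
        Real.pi * S + n * (Real.pi * |l.im| + |b|) := by
      rw [Finset.sum_add_distrib, ← Finset.mul_sum, Finset.sum_const, Finset.card_univ,
        Fintype.card_fin, nsmul_eq_mul]
    rw [h3'] at h3
    have h7 : n * Real.pi * |l.im| - |l.im| ^ 2 ≤ (n * Real.pi) ^ 2 / 4 := by
      nlinarith [sq_nonneg (|l.im| - n * Real.pi / 2)]
    rw [sq_abs] at h7
    have h8 : l.re ^ 2 ≤ 1 := pow_le_one₀ hl.1 hl.2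
    have h9 : (n : ℝ) * (Real.pi * |l.im| + |b|) = n * Real.pi * |l.im| + n * |b| := by ring
    linarith
  have hcl : ∀ l ∈ closure (HadamardThreeLines.verticalStrip 0 1), (0 : ℝ) ≤ l.re := by
    intro l hl
    have : HadamardThreeLines.verticalStrip 0 1 ⊆ {l : ℂ | 0 ≤ l.re} := fun x hx => hx.1.le
    exact closure_minimal this (isClosed_le continuous_const continuous_re) hl
  have h3l := HadamardThreeLines.norm_le_interp_of_mem_verticalClosedStrip₀₁' u (z := (c : ℂ))
    (a := Real.exp (homPart ε a η + C₁)) (b := Real.exp (Real.pi * S + C₂))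
    (show (c : ℂ).re ∈ Set.Icc (0 : ℝ) 1 from ⟨hc.1.le, hc.2⟩)
    (DifferentiableOn.diffContOnCl fun l hl => (hud l (hcl l hl)).differentiableWithinAt)
    ⟨_, by
      rintro _ ⟨l, hl, rfl⟩
      exact hstrip l hl⟩ hleft
    (fun l hl => hstrip l (by rw [show l.re = 1 from hl]; simp))
  have hpc : p c = ζ := by
    funext j
    have hc0 : (c : ℂ) ≠ 0 := by exact_mod_cast hc.1.ne'
    simp only [hp, hv, hη]
    push_cast
    rw [mul_div_cancel₀ _ hc0, re_add_im]
  have hlow : ‖φ ζ‖ ≤ ‖u c‖ := by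
    rw [hu, norm_mul, hsq, hpc]
    refine le_mul_of_one_le_right (norm_nonneg _) (Real.one_le_exp ?_)
    simp
    positivity
  refine hlow.trans (h3l.trans ?_)
  rw [ofReal_re, ← Real.exp_mul, ← Real.exp_mul, ← Real.exp_add, ← Real.exp_add, Real.exp_le_exp]
  have h5 := (neg_abs_le (homPart ε a η)).trans' (neg_le_neg (abs_homPart_le hε η))
  rw [← hL, ← hS] at h5
  have h6 : c * (-homPart ε a η) ≤ c * (L * S) := by
    have := hc.1
    gcongr
    linarith
  have h7 : C₁ * (1 - c) ≤ |C₁| := by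
    refine (le_abs_self _).trans ?_
    rw [abs_mul]
    exact mul_le_of_le_one_right (abs_nonneg _) (abs_le.2 ⟨by linarith [hc.2], by linarith [hc.1]⟩)
  have h8 : C₂ * c ≤ |C₂| := by
    refine (le_abs_self _).trans ?_
    rw [abs_mul, abs_of_pos hc.1]
    exact mul_le_of_le_one_right (abs_nonneg _) hc.2
  nlinarith

/-! ### Analyticity of the Lindelöf integral -/

/-- The bounds for `φ`, for the kernels and for `e^{⟨ζ, w⟩}` combine to the slack of `Im w` at
`Im ζ`. -/
theorem norm_lindelof_integrand_le {φ : (Fin n → ℂ) → ℂ} {K M c r : ℝ} (hK0 : 0 ≤ K)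
    (hc : c ∈ Set.Ioo (0 : ℝ) (1 / 4)) {w ζ : Fin n → ℂ} (hζ : ∀ j, ζ j = 0 ∨ (ζ j).re = c)
    (hb : ‖φ ζ‖ ≤ K * Real.exp (homPart ε a (fun j => (ζ j).im) + c * M * ∑ j, |(ζ j).im|))
    (hw : 0 ≤ slack ε a r (fun j => (w j).im) fun j => (ζ j).im) :
    ‖φ ζ * ∏ j, (kernel (ζ j) * exp (ζ j * w j))‖ ≤
      K * kernelBound c ^ n * Real.exp (∑ j, c * |(w j).re|) *
        Real.exp (-((r - c * M) * ∑ j, |(ζ j).im|)) := by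
  have hprod : ∏ j, ‖kernel (ζ j) * exp (ζ j * w j)‖ ≤ kernelBound c ^ n *
      Real.exp (∑ j, (Real.pi * ((ζ j).im - |(ζ j).im|) +
        (c * |(w j).re| - (ζ j).im * (w j).im))) := by
    have e : kernelBound c ^ n = ∏ _j : Fin n, kernelBound c := by simp
    rw [Real.exp_sum, e, ← Finset.prod_mul_distrib]
    refine Finset.prod_le_prod (fun _ _ => norm_nonneg _) fun j _ => ?_
    rw [norm_mul, norm_exp, mul_re, Real.exp_add, ← mul_assoc]
    refine mul_le_mul (norm_kernel_le hc (hζ j)) (Real.exp_le_exp.2 ?_) (Real.exp_pos _).le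
      (mul_nonneg (kernelBound_pos c).le (Real.exp_pos _).le)
    have h := re_mem_Icc_of_mem_contour hc.1.le (hζ j)
    have h1 : (ζ j).re * (w j).re ≤ c * |(w j).re| :=
      (mul_le_mul_of_nonneg_left (le_abs_self _) h.1).trans
        (mul_le_mul_of_nonneg_right h.2 (abs_nonneg _))
    linarith
  have hH := kernelBound_pos c
  rw [norm_mul, norm_prod]
  refine (mul_le_mul hb hprod (Finset.prod_nonneg fun _ _ => norm_nonneg _)
    (by positivity)).trans ?_
  set S := ∑ j, |(ζ j).im| with hS
  calc _ = K * kernelBound c ^ n * Real.exp ((homPart ε a (fun j => (ζ j).im) + c * M * S) +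
        ∑ j, (Real.pi * ((ζ j).im - |(ζ j).im|) + (c * |(w j).re| - (ζ j).im * (w j).im))) := by
        rw [Real.exp_add _ (∑ j, _)]; ring
    _ ≤ K * kernelBound c ^ n * Real.exp (∑ j, c * |(w j).re| + -((r - c * M) * S)) := by
        refine mul_le_mul_of_nonneg_left (Real.exp_le_exp.2 ?_) (by positivity)
        unfold slack gLin at hw
        unfold homPart
        rw [Finset.sum_add_distrib, Finset.sum_sub_distrib, ← Finset.mul_sum]
        linarith
    _ = _ := by rw [Real.exp_add]; ring

/-- The Lindelöf integral over the contours through `c` is holomorphic on the tube over the vectors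
for which the margin exceeds the loss `c M` in the growth of `φ`. -/
theorem differentiableAt_lindelofIntegral {φ : (Fin n → ℂ) → ℂ} {K M c : ℝ} (hK0 : 0 ≤ K)
    (hc : c ∈ Set.Ioo (0 : ℝ) (1 / 4))
    (hφ : ∀ ζ ∈ closedRightDomain n, DifferentiableAt ℂ φ ζ)
    (hb : ∀ ζ : Fin n → ℂ, (∀ j, (ζ j).re ∈ Set.Icc 0 c) →
      ‖φ ζ‖ ≤ K * Real.exp (homPart ε a (fun j => (ζ j).im) + c * M * ∑ j, |(ζ j).im|))
    {w₀ : Fin n → ℂ} (hw₀ : (fun j => (w₀ j).im) ∈ marginSet ε a (c * M)) :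
    DifferentiableAt ℂ (lindelofIntegral φ c) w₀ := by
  obtain ⟨r, hr, hslack⟩ := hw₀
  set ρ := (r - c * M) / 2 with hρ
  have hρ0 : 0 < ρ := by linarith
  set B := K * kernelBound c ^ n * Real.exp (∑ j, c * (|(w₀ j).re| + ρ)) with hB
  have hmeasφ := aestronglyMeasurable_of_continuousOn hc.1.le fun ζ hζ =>
    (hφ ζ hζ).continuousAt.continuousWithinAt
  have hrew : ∀ (w ζ : Fin n → ℂ), φ ζ * ∏ j, (kernel (ζ j) * exp (ζ j * w j)) =
      (φ ζ * ∏ j, kernel (ζ j)) * exp (∑ j, ζ j * w j) := by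
    intro w ζ
    rw [Finset.prod_mul_distrib, exp_sum, mul_assoc]
  have hderiv : ∀ w ζ : Fin n → ℂ, HasFDerivAt
      (fun w : Fin n → ℂ => φ ζ * ∏ j, (kernel (ζ j) * exp (ζ j * w j)))
      ((φ ζ * ∏ j, (kernel (ζ j) * exp (ζ j * w j))) •
        ∑ j, ζ j • (ContinuousLinearMap.proj j : (Fin n → ℂ) →L[ℂ] ℂ)) w := by
    intro w ζ
    simp only [hrew]
    have h1 : HasFDerivAt (fun w : Fin n → ℂ => ∑ j, ζ j * w j)
        (∑ j, ζ j • (ContinuousLinearMap.proj j : (Fin n → ℂ) →L[ℂ] ℂ)) w :=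
      HasFDerivAt.fun_sum fun j _ => (hasFDerivAt_apply j w).const_mul (ζ j)
    have h2 := (h1.cexp).const_mul (φ ζ * ∏ j, kernel (ζ j))
    rwa [smul_smul] at h2
  have hbound : Integrable (fun ζ : Fin n → ℂ => B * ∏ j, Real.exp (-(ρ * |(ζ j).im|)))
      (contourMeasurePi n c) :=
    Integrable.const_mul (Integrable.fintype_prod (f := fun _ (z : ℂ) => Real.exp (-(ρ * |z.im|)))
      fun _ => integrable_exp_neg_mul_abs_im c hρ0) B
  have hmeas : ∀ w : Fin n → ℂ, AEStronglyMeasurable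
      (fun ζ : Fin n → ℂ => φ ζ * ∏ j, (kernel (ζ j) * exp (ζ j * w j))) (contourMeasurePi n c) :=
    fun w => hmeasφ.mul (measurable_prod_kernel w).aestronglyMeasurable
  refine differentiableAt_integral_of_dominated hρ0 hbound (fun w _ => hmeas w) ?_
    (Eventually.of_forall fun ζ w _ => (hderiv w ζ).differentiableAt) ?_
  · have e : (fun ζ : Fin n → ℂ => fderiv ℂ
        (fun w : Fin n → ℂ => φ ζ * ∏ j, (kernel (ζ j) * exp (ζ j * w j))) w₀) = fun ζ =>
        (φ ζ * ∏ j, (kernel (ζ j) * exp (ζ j * w₀ j))) •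
        ∑ j, ζ j • (ContinuousLinearMap.proj j : (Fin n → ℂ) →L[ℂ] ℂ) :=
      funext fun ζ => (hderiv w₀ ζ).fderiv
    rw [e]
    refine (hmeas w₀).smul (Continuous.aestronglyMeasurable ?_)
    exact continuous_finsetSum _ fun j _ => (continuous_apply j).smul continuous_const
  · filter_upwards [ae_contourMeasurePi n c] with ζ hζ w hw
    have hcoord : ∀ j, ‖w j - w₀ j‖ ≤ ρ := fun j => by
      have := (dist_le_pi_dist w w₀ j).trans (Metric.mem_ball.1 hw).le
      rwa [dist_eq_norm] at this
    have hs := slack_sub_le (ε := ε) (a := a) (r := r) (α := fun j => (w₀ j).im)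
      (α' := fun j => (w j).im) (d := ρ)
      (fun j => ((abs_im_le_norm (w j - w₀ j)).trans (hcoord j))) fun j => (ζ j).im
    have h := norm_lindelof_integrand_le hK0 hc hζ
      (hb ζ fun j => re_mem_Icc_of_mem_contour hc.1.le (hζ j)) ((hslack _).trans hs)
    refine h.trans ?_
    have e : ∏ j, Real.exp (-(ρ * |(ζ j).im|)) =
        Real.exp (-((r - ρ - c * M) * ∑ j, |(ζ j).im|)) := by
      rw [← Real.exp_sum, Finset.sum_neg_distrib, ← Finset.mul_sum]
      congr 3
      linarith
    rw [e]
    refine mul_le_mul_of_nonneg_right ?_ (Real.exp_pos _).le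
    have hH := kernelBound_pos c
    refine mul_le_mul_of_nonneg_left (Real.exp_le_exp.2 (Finset.sum_le_sum fun j _ => ?_))
      (by positivity)
    refine mul_le_mul_of_nonneg_left ?_ hc.1.le
    have h1 := (abs_re_le_norm (w j - w₀ j)).trans (hcoord j)
    rw [sub_re] at h1
    linarith [abs_sub_abs_le_abs_sub (w j).re (w₀ j).re]

end

/-! ### Gluing continuations over tubes -/

section

variable {n : ℕ} {f : (Fin n → ℕ) → ℂ} {ι : Type*} {A : ι → Set (Fin n → ℝ)}
  {G : ι → (Fin n → ℂ) → ℂ}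

theorem continuous_im_pi : Continuous fun (w : Fin n → ℂ) (j : Fin n) => (w j).im := by fun_prop

theorem continuous_exp_pi : Continuous fun (w : Fin n → ℂ) (j : Fin n) => exp (w j) := by fun_prop

theorem convex_tube {s : Set (Fin n → ℝ)} (hs : Convex ℝ s) (v : Fin n → ℂ) :
    Convex ℝ {w : Fin n → ℂ | (fun j => (v j + w j).im) ∈ s} := by
  intro x hx y hy a b ha hb hab
  have := hs hx hy ha hb hab
  rw [Set.mem_ofPred_eq]
  convert this using 1
  funext j
  obtain rfl : b = 1 - a := by linarith
  simp
  ring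

/-- Continuations to two tubes take the same value at two logarithms of the same point: after
translation they agree far to the left, where both are the sum of the series. -/
theorem tube_continuation_unique (hAo : ∀ i, IsOpen (A i)) (hAc : ∀ i, Convex ℝ (A i))
    (hG : ∀ i w, (fun j => (w j).im) ∈ A i → DifferentiableAt ℂ (G i) w)
    (h0 : (0 : Fin n → ℂ) ∈ convergenceDomain f)
    (hGs : ∀ i w, (fun j => (w j).im) ∈ A i → (fun j => exp (w j)) ∈ convergenceDomain f →
      G i w = ∑' k, term f (fun j => exp (w j)) k)
    {i i' : ι} {w w' : Fin n → ℂ} (hw : (fun j => (w j).im) ∈ A i)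
    (hw' : (fun j => (w' j).im) ∈ A i') (hexp : ∀ j, exp (w j) = exp (w' j)) :
    G i w = G i' w' := by
  set T : Set (Fin n → ℂ) := {u | (fun j => (w j + u j).im) ∈ A i} ∩
    {u | (fun j => (w' j + u j).im) ∈ A i'} with hT
  have hTo : IsOpen T := ((hAo i).preimage (by fun_prop)).inter ((hAo i').preimage (by fun_prop))
  have hTc : Convex ℝ T := (convex_tube (hAc i) w).inter (convex_tube (hAc i') w')
  have hlim : Tendsto (fun R : ℝ => fun j => exp (w j + ((-R : ℝ) : ℂ))) atTop (𝓝 0) := by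
    refine tendsto_pi_nhds.2 fun j => tendsto_zero_iff_norm_tendsto_zero.2 ?_
    simp only [norm_exp, add_re, ofReal_re]
    exact Real.tendsto_exp_atBot.comp (tendsto_atBot_add_const_left _ _ tendsto_neg_atTop_atBot)
  obtain ⟨R, hR⟩ := (hlim.eventually (isOpen_convergenceDomain.mem_nhds h0)).exists
  set u₀ : Fin n → ℂ := fun _ => ((-R : ℝ) : ℂ) with hu₀
  have hu₀T : u₀ ∈ T := by
    refine ⟨?_, ?_⟩
    · simpa [hu₀] using hw
    · simpa [hu₀] using hw'
  have key := eqOn_of_convex_of_eventuallyEq hTo hTc (F := fun u => G i (fun j => w j + u j))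
    (G := fun u => G i' (fun j => w' j + u j)) (w₀ := u₀) (w := 0)
    (fun u hu => (hG i _ hu.1).comp u (by fun_prop))
    (fun u hu => (hG i' _ hu.2).comp u (by fun_prop)) hu₀T ?_ ?_
  · simpa using key
  · have hD : ∀ᶠ u : Fin n → ℂ in 𝓝 u₀, (fun j => exp (w j + u j)) ∈ convergenceDomain f :=
      (isOpen_convergenceDomain.preimage (by fun_prop :
        Continuous fun (u : Fin n → ℂ) (j : Fin n) => exp (w j + u j))).mem_nhds hR
    filter_upwards [hD, hTo.mem_nhds hu₀T] with u hu huT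
    have e : (fun j => exp (w' j + u j)) = fun j => exp (w j + u j) := by
      funext j; rw [exp_add, exp_add, hexp j]
    rw [hGs i _ huT.1 hu, hGs i' _ huT.2 (by rw [e]; exact hu), e]
  · exact ⟨by simpa using hw, by simpa using hw'⟩

/-- Holomorphic functions on tubes over open convex sets `A i` of arguments, each equal to the sum
of the power series wherever the series converges, descend to a single analytic continuation. -/
theorem sumExtendsInto_iUnion (hAo : ∀ i, IsOpen (A i)) (hAc : ∀ i, Convex ℝ (A i))
    (hG : ∀ i w, (fun j => (w j).im) ∈ A i → DifferentiableAt ℂ (G i) w)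
    (h0 : (0 : Fin n → ℂ) ∈ convergenceDomain f)
    (hGs : ∀ i w, (fun j => (w j).im) ∈ A i → (fun j => exp (w j)) ∈ convergenceDomain f →
      G i w = ∑' k, term f (fun j => exp (w j)) k) :
    SumExtendsInto f (argPreimage (⋃ i, A i)) := by
  classical
  set F : (Fin n → ℂ) → ℂ := fun z =>
    if h : ∃ p : ι × (Fin n → ℂ), (fun j => (p.2 j).im) ∈ A p.1 ∧ (fun j => exp (p.2 j)) = z then
      G h.choose.1 h.choose.2 else ∑' k, term f z k with hF
  have hFexp : ∀ i w, (fun j => (w j).im) ∈ A i → F (fun j => exp (w j)) = G i w := by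
    intro i w hw
    have h : ∃ p : ι × (Fin n → ℂ), (fun j => (p.2 j).im) ∈ A p.1 ∧
        (fun j => exp (p.2 j)) = fun j => exp (w j) := ⟨(i, w), hw, rfl⟩
    simp only [hF, dif_pos h]
    exact tube_continuation_unique hAo hAc hG h0 hGs h.choose_spec.1 hw
      fun j => congrFun h.choose_spec.2 j
  have hFsum : ∀ z ∈ convergenceDomain f, F z = ∑' k, term f z k := by
    intro z hz
    by_cases h : ∃ p : ι × (Fin n → ℂ), (fun j => (p.2 j).im) ∈ A p.1 ∧ (fun j => exp (p.2 j)) = z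
    · obtain ⟨⟨i, w⟩, hw, rfl⟩ := h
      rw [hFexp i w hw, hGs i w hw hz]
    · simp only [hF, dif_neg h]
  have hdiffD : ∀ z ∈ convergenceDomain f, DifferentiableAt ℂ F z := fun z hz =>
    (differentiableAt_tsum_term hz).congr_of_eventuallyEq
      (by filter_upwards [isOpen_convergenceDomain.mem_nhds hz] with y hy using hFsum y hy)
  -- near `e^{w₀}` the logarithm `w₀ + log (z / e^{w₀})` stays in the tube
  have hlog : ∀ i (w₀ : Fin n → ℂ), (fun j => (w₀ j).im) ∈ A i → ∃ l : (Fin n → ℂ) → Fin n → ℂ,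
      DifferentiableAt ℂ l (fun j => exp (w₀ j)) ∧ l (fun j => exp (w₀ j)) = w₀ ∧
      ∀ᶠ z in 𝓝 (fun j => exp (w₀ j)),
        (fun j => (l z j).im) ∈ A i ∧ (fun j => exp (l z j)) = z := by
    intro i w₀ hw₀
    set l : (Fin n → ℂ) → Fin n → ℂ := fun z j => w₀ j + log (z j / exp (w₀ j)) with hl
    have hld : DifferentiableAt ℂ l (fun j => exp (w₀ j)) := by
      refine differentiableAt_pi.2 fun j => ?_
      have h1 : DifferentiableAt ℂ (fun z : Fin n → ℂ => z j / exp (w₀ j))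
        (fun j => exp (w₀ j)) := by fun_prop
      exact (h1.clog (by simp)).const_add _
    have hlw : l (fun j => exp (w₀ j)) = w₀ := by funext j; simp [hl]
    refine ⟨l, hld, hlw, ?_⟩
    have h1 : ∀ᶠ z in 𝓝 (fun j => exp (w₀ j)), (fun j => (l z j).im) ∈ A i := by
      have hc : ContinuousAt (fun z => fun j => (l z j).im) (fun j => exp (w₀ j)) :=
        (continuous_im_pi.continuousAt).comp hld.continuousAt
      refine hc.eventually ((hAo i).mem_nhds ?_)
      change (fun j => (l (fun j => exp (w₀ j)) j).im) ∈ A i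
      rw [hlw]
      exact hw₀
    have h2 : ∀ᶠ z in 𝓝 (fun j => exp (w₀ j)), ∀ j, z j ≠ 0 :=
      eventually_all.2 fun j => (continuous_apply j).continuousAt.eventually_ne (exp_ne_zero _)
    filter_upwards [h1, h2] with z hz1 hz2
    refine ⟨hz1, funext fun j => ?_⟩
    have h3 : z j / exp (w₀ j) ≠ 0 := div_ne_zero (hz2 j) (exp_ne_zero _)
    simp only [hl]
    rw [exp_add, exp_log h3, mul_div_cancel₀ _ (exp_ne_zero _)]
  have hdiffA : ∀ i (w₀ : Fin n → ℂ), (fun j => (w₀ j).im) ∈ A i →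
      DifferentiableAt ℂ F (fun j => exp (w₀ j)) := by
    intro i w₀ hw₀
    obtain ⟨l, hld, hlw, hev⟩ := hlog i w₀ hw₀
    have h1 : DifferentiableAt ℂ (fun z => G i (l z)) (fun j => exp (w₀ j)) := by
      refine DifferentiableAt.comp (g := G i) _ ?_ hld
      rw [hlw]
      exact hG i w₀ hw₀
    refine h1.congr_of_eventuallyEq ?_
    filter_upwards [hev] with z hz
    rw [← hFexp i _ hz.1, hz.2]
  refine ⟨h0, F, ⟨{z | ∀ᶠ y in 𝓝 z, DifferentiableAt ℂ F y}, isOpen_setOfPred_eventually_nhds, ?_,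
    fun z hz => hz.self_of_nhds.differentiableWithinAt⟩, fun z hz => ?_⟩
  · rintro z (hz | ⟨α, hα, hz⟩)
    · filter_upwards [isOpen_convergenceDomain.mem_nhds hz] with y hy using hdiffD y hy
    · obtain ⟨i, hi⟩ := Set.mem_iUnion.1 hα
      set w₀ : Fin n → ℂ := fun j => (Real.log ‖z j‖ : ℝ) + α j * I with hw₀
      have hw₀A : (fun j => (w₀ j).im) ∈ A i := by simpa [hw₀] using hi
      have hexp : (fun j => exp (w₀ j)) = z := by
        funext j
        rw [hw₀, exp_add, ← ofReal_exp, Real.exp_log (norm_pos_iff.2 (hz j).1)]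
        exact (hz j).2.symm
      obtain ⟨l, -, -, hev⟩ := hlog i w₀ hw₀A
      rw [hexp] at hev
      filter_upwards [hev] with y hy
      have := hdiffA i _ hy.1
      rwa [hy.2] at this
  · rw [hFsum z hz]
    exact (summable_term hz).hasSum

end

theorem SumExtendsInto.mono {n : ℕ} {f : (Fin n → ℕ) → ℂ} {S S' : Set (Fin n → ℂ)}
    (h : SumExtendsInto f S') (hS : S ⊆ S') : SumExtendsInto f S := by
  obtain ⟨h0, F, ⟨U, hU, hsub, hF⟩, hsum⟩ := h
  exact ⟨h0, F, ⟨U, hU, (Set.union_subset_union_right _ hS).trans hsub, hF⟩, hsum⟩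

/-- The Lindelöf integral is the sum of the series wherever the series converges: this holds near a
point with arguments `(π, …, π)`, and the identity theorem does the rest. -/
theorem lindelofIntegral_eq_tsum_term {n q : ℕ} {a : Fin q → Fin n → ℝ} {ε : Fin q → ℝ}
    {f : (Fin n → ℕ) → ℂ} {φ : (Fin n → ℂ) → ℂ} {K M c b C δ : ℝ} (hK0 : 0 ≤ K)
    (hc : c ∈ Set.Ioo (0 : ℝ) (1 / 4)) (hδ : 0 < δ)
    (hφ : ∀ ζ ∈ closedRightDomain n, DifferentiableAt ℂ φ ζ)
    (hf : Interpolates φ f)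
    (hb : ∀ ζ : Fin n → ℂ, (∀ j, (ζ j).re ∈ Set.Icc 0 c) →
      ‖φ ζ‖ ≤ K * Real.exp (homPart ε a (fun j => (ζ j).im) + c * M * ∑ j, |(ζ j).im|))
    (h₂ : ∀ ζ ∈ closedRightDomain n,
      ‖φ ζ‖ ≤ Real.exp C * ∏ j, Real.exp ((Real.pi - δ) * |(ζ j).im| + b * (ζ j).re))
    (hball : ∀ z : Fin n → ℂ, (∀ j, ‖z j‖ < Real.exp (-b - 1)) → z ∈ convergenceDomain f)
    {w : Fin n → ℂ} (hw : (fun j => (w j).im) ∈ marginSet ε a (c * M))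
    (hwD : (fun j => exp (w j)) ∈ convergenceDomain f) :
    lindelofIntegral φ c w = ∑' k, term f (fun j => exp (w j)) k := by
  set T : Set (Fin n → ℂ) := {w | (fun j => (w j).im) ∈ marginSet ε a (c * M)} ∩
    {w | (fun j => exp (w j)) ∈ convergenceDomain f} with hT
  have hTo : IsOpen T := ((isOpen_marginSet _).preimage continuous_im_pi).inter
    (isOpen_convergenceDomain.preimage continuous_exp_pi)
  have hTc : Convex ℝ T := by
    refine Convex.inter ?_ convex_exp_preimage_convergenceDomain
    simpa using convex_tube (convex_marginSet (ε := ε) (a := a) (c * M)) 0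
  set w₀ : Fin n → ℂ := fun _ => ((-b - 2 : ℝ) : ℂ) + Real.pi * I with hw₀
  have hre : ∀ j, (w₀ j).re = -b - 2 := fun j => by simp [hw₀]
  have him : ∀ j, (w₀ j).im = Real.pi := fun j => by simp [hw₀]
  have hw₀T : w₀ ∈ T := by
    refine ⟨?_, hball _ fun j => ?_⟩
    · simp only [Set.mem_ofPred_eq, him]
      exact pi_mem_marginSet hw
    · rw [norm_exp, hre j, Real.exp_lt_exp]
      linarith
  refine eqOn_of_convex_of_eventuallyEq hTo hTc (w₀ := w₀)
    (fun v hv => differentiableAt_lindelofIntegral hK0 hc hφ hb hv.1)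
    (G := fun w => ∑' k, term f (fun j => exp (w j)) k)
    (fun v hv => DifferentiableAt.comp (g := fun z => ∑' k, term f z k)
      (f := fun (w : Fin n → ℂ) j => exp (w j)) v (differentiableAt_tsum_term hv.2) (by fun_prop))
    hw₀T ?_ ⟨hw, hwD⟩
  have h1 : ∀ᶠ v : Fin n → ℂ in 𝓝 w₀, ∀ j, (v j).re < -b := eventually_all.2 fun j => by
    refine (isOpen_lt (by fun_prop : Continuous fun v : Fin n → ℂ => (v j).re)
      continuous_const).mem_nhds ?_
    rw [Set.mem_ofPred_eq, hre j]
    linarith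
  have h2 : ∀ᶠ v : Fin n → ℂ in 𝓝 w₀, ∀ j, |(v j).im - Real.pi| < δ :=
    eventually_all.2 fun j => by
    refine (isOpen_lt (by fun_prop : Continuous fun v : Fin n → ℂ => |(v j).im - Real.pi|)
      continuous_const).mem_nhds ?_
    rw [Set.mem_ofPred_eq, him j]
    simpa using hδ
  filter_upwards [h1, h2] with v hv1 hv2
  rw [lindelofIntegral_eq_tsum hc hφ (Real.exp_pos C).le h₂
    (fun j => by simpa using hv2 j) hv1]
  refine tsum_congr fun k => ?_
  rw [term, ← hf k]
  congr 1
  exact Finset.prod_congr rfl fun j _ => exp_nat_mul _ _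

end LeRoyLindelof

theorem mainTheorem1 (n q : ℕ)
    (ε : Fin q → ℝ) (hε : ∀ p, ε p = 1 ∨ ε p = -1)
    (a : Fin q → Fin n → ℝ) (a₀ : Fin q → ℝ)
    (f : (Fin n → ℕ) → ℂ) (φ : (Fin n → ℂ) → ℂ)
    (hφ : LeRoyLindelof.HolomorphicOn φ (LeRoyLindelof.closedRightDomain n))
    (hf : LeRoyLindelof.Interpolates φ f)
    (h₁ : ∀ η : Fin n → ℝ,
      ‖φ (fun j => (η j : ℂ) * Complex.I)‖ ≤ Real.exp (LeRoyLindelof.gTilde ε a a₀ η))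
    (b C δ : ℝ) (hδ : 0 < δ)
    (h₂ : ∀ ζ ∈ LeRoyLindelof.closedRightDomain n,
      ‖φ ζ‖ ≤ Real.exp ((∑ j, ((Real.pi - δ) * |(ζ j).im| + b * (ζ j).re)) + C)) :
    LeRoyLindelof.SumExtendsInto f
      (LeRoyLindelof.argPreimage (interior (LeRoyLindelof.polytope ε a))) := by
  open LeRoyLindelof in
  obtain ⟨U, hU, hsub, hUd⟩ := hφ
  have hφd : ∀ ζ ∈ closedRightDomain n, DifferentiableAt ℂ φ ζ := fun ζ hζ =>
    hUd.differentiableAt (hU.mem_nhds (hsub hζ))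
  obtain ⟨K, M, hK0, hM0, hKM⟩ := exists_norm_le_near_imaginary hε hφd h₁ hδ h₂
  have h₂' : ∀ ζ ∈ closedRightDomain n,
      ‖φ ζ‖ ≤ Real.exp C * ∏ j, Real.exp ((Real.pi - δ) * |(ζ j).im| + b * (ζ j).re) := by
    intro ζ hζ
    rw [← Real.exp_sum, ← Real.exp_add, add_comm]
    exact h₂ ζ hζ
  have hball : ∀ z : Fin n → ℂ, (∀ j, ‖z j‖ < Real.exp (-b - 1)) → z ∈ convergenceDomain f :=
    fun z hz => mem_convergenceDomain_of_norm_lt (b := b) (C := Real.exp C) (fun k => by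
      have := h₂' (fun j => (k j : ℂ)) fun j => by simp
      rw [hf k] at this
      simpa using this) hz
  have hKMc : ∀ c : Set.Ioo (0 : ℝ) (1 / 4), ∀ ζ : Fin n → ℂ, (∀ j, (ζ j).re ∈ Set.Icc 0 c.1) →
      ‖φ ζ‖ ≤ K * Real.exp (homPart ε a (fun j => (ζ j).im) + c.1 * M * ∑ j, |(ζ j).im|) :=
    fun c => hKM c.1 ⟨c.2.1, by linarith [c.2.2]⟩
  have key := sumExtendsInto_iUnion (f := f) (ι := Set.Ioo (0 : ℝ) (1 / 4))
    (A := fun c => marginSet ε a (c.1 * M)) (G := fun c => lindelofIntegral φ c.1)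
    (fun c => isOpen_marginSet _) (fun c => convex_marginSet _)
    (fun c w hw => differentiableAt_lindelofIntegral hK0 c.2 hφd (hKMc c) hw)
    (hball 0 fun j => by simpa using Real.exp_pos _)
    (fun c w hw hwD => lindelofIntegral_eq_tsum_term hK0 c.2 hδ hφd hf (hKMc c) h₂' hball hw hwD)
  refine key.mono ?_
  rintro z ⟨α, hα, hz⟩
  obtain ⟨r, hr, hslack⟩ := interior_polytope_subset hα
  -- any `c < 1 / 4` with `c M < r` will do
  have hpos : 0 < min (1 / 8) (r / (M + 1)) := lt_min (by norm_num) (by positivity)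
  refine ⟨α, Set.mem_iUnion.2 ⟨⟨min (1 / 8) (r / (M + 1)), hpos,
    (min_le_left _ _).trans_lt (by norm_num)⟩, r, ?_, hslack⟩, hz⟩
  calc min (1 / 8) (r / (M + 1)) * M ≤ r / (M + 1) * M := by
        gcongr
        exact min_le_right _ _
    _ < r := by
        rw [div_mul_eq_mul_div, div_lt_iff₀ (by positivity)]
        nlinarith
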